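/- Let $q=2^k$ with $k\ge 1$, let $\upsilon\in \mathrm{GF}(q^2)$ satisfy $\upsilon^q+\upsilon=1$, and put $\delta=\upsilon^{q+1}\in\mathrm{GF}(q)$. Let $\mathrm{H}(3,q^2)$ be the Hermitian space (totally isotropic points and lines) of the form $x_1y_2^q+x_2y_1^q+x_3y_4^q+x_4y_3^q$ on $\mathrm{GF}(q^2)^4$, and let $\mathrm{W}(3,q)$ be the symplectic space embedded in it, whose points are the points of $\mathrm{PG}(3,q^2)$ with a coordinate vector over $\mathrm{GF}(q)$. The set $\mathcal P_E$ of external points consists of the points of $\mathrm{H}(3,q^2)$ not in $\mathrm{W}(3,q)$, and the set $\mathcal L_E$ of external lines consists of the lines of $\mathrm{H}(3,q^2)$ disjoint from $\mathrm{W}(3,q)$. A relative hemisystem is a set of external lines containing, for every external point $P$, exactly half of the external lines through $P$. Let $\mathcal Q^+$ be the hyperbolic quadric $x_1^2+\delta x_2^2+x_1x_2+x_3x_4=0$ of $\mathrm{PG}(3,q^2)$, with reguli $$\mathscr R_1=\{\langle(\upsilon^q,1,0,\lambda),(\lambda\upsilon,\lambda,1,0)\rangle:\lambda\in\mathrm{GF}(q^2)\}\cup\{\langle(0,0,0,1),(\upsilon,1,0,0)\rangle\},$$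 $$\mathscr R_2=\{\langle(\upsilon^q,1,\lambda,0),(\lambda\upsilon,\lambda,0,1)\rangle:\lambda\in\mathrm{GF}(q^2)\}\cup\{\langle(0,0,1,0),(\upsilon,1,0,0)\rangle\}.$$ Let $\overline G=\mathrm{PSO}^-(4,q)$ and $G=\mathrm P\Omega^-(4,q)$ be the groups of permutations of the points of $\mathrm{PG}(3,q^2)$ induced by the matrices over $\mathrm{GF}(q)$ that are, respectively, isometries of determinant $1$ of the elliptic quadratic form $x_1^2+\delta x_2^2+x_1x_2+x_3x_4$ on $\mathrm{GF}(q)^4$, and products of an even number of reflections of this form. The Penttila–Williford relative hemisystems are the orbits of $\mathrm P\Omega^-(4,q)$ on $\mathcal L_E$. Then: 1. $\overline G$ and $G$ fix $\mathcal Q^+$; more precisely, $\overline G$ is the stabiliser of $\mathcal Q^+$ in $\mathrm{PGU}(4,q)$, and $G$ is the subgroup of $\overline G$ stabilising each of the reguli $\mathscr R_1$, $\mathscr R_2$. 2. $(G,\overline G)$ satisfies the hypotheses of the following criterion: $\overline G\le\mathrm{PSO}^-(4,q)$, $G=\overline G\cap\mathrm P\Omega^-(4,q)$, and for every external point $P$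 the stabiliser $\overline G_P$ is not contained in $\mathrm P\Omega^-(4,q)$. 3. Consequently $G<\overline G$ are groups of collineations of $\mathrm{H}(3,q^2)$ stabilising $\mathrm{W}(3,q)$, with $|\overline G:G|=2$; $\overline G$ acts semiregularly on the set $\mathcal L_E/G$ of $G$-orbits on $\mathcal L_E$ (every element of $\overline G$ fixing some element of $\mathcal L_E/G$ is in the kernel of the action), and the kernel of this action is $G$; and $\mathcal P_E/\overline G=\mathcal P_E/G$. 4. There are exactly two Penttila–Williford relative hemisystems, each of them is a relative hemisystem invariant under $G$, and they are exactly the sets determined by $(G,\overline G)$, that is, the sets $\bigcup_i \ell_i^G$ where the $\ell_i$ form a set of representatives of the $\overline G$-orbits on $\mathcal L_E$. -/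

import Mathlib

open scoped Pointwise Matrix MatrixGroups LinearAlgebra.Projectivization

namespace RelHemi

/-! ### Points and lines of `PG(3, K)` -/

/-- The points of `PG(3, K)`. -/
abbrev Pt (K : Type*) [Field K] : Type _ := ℙ K (Fin 4 → K)

/-- The set of projective points contained in a linear subspace. -/
def pointsOf {K : Type*} [Field K] (L : Submodule K (Fin 4 → K)) : Set (Pt K) :=
  {p | p.submodule ≤ L}

/-- The line spanned by two vectors, as a set of points. -/
def lineThrough {K : Type*} [Field K] (x y : Fin 4 → K) : Set (Pt K) :=
  pointsOf (Submodule.span K {x, y})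

/-- The lines of `PG(3, K)`, as sets of points. -/
def projLines (K : Type*) [Field K] : Set (Set (Pt K)) :=
  {ℓ | ∃ L : Submodule K (Fin 4 → K), Module.finrank K L = 2 ∧ ℓ = pointsOf L}

/-! ### The Hermitian space `H(3, q²)`, the embedded `W(3, q)`, external points and lines -/

/-- The Hermitian form `x₁ y₂^q + x₂ y₁^q + x₃ y₄^q + x₄ y₃^q`. -/
def hermForm {K : Type*} [Field K] (q : ℕ) (x y : Fin 4 → K) : K :=
  x 0 * y 1 ^ q + x 1 * y 0 ^ q + x 2 * y 3 ^ q + x 3 * y 2 ^ q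

/-- The points of `H(3, q²)`: the totally isotropic points of the Hermitian form. -/
def hermPoints (K : Type*) [Field K] (q : ℕ) : Set (Pt K) :=
  {p | ∀ v ∈ p.submodule, hermForm q v v = 0}

/-- The lines of `H(3, q²)`: the totally isotropic lines of the Hermitian form. -/
def hermLines (K : Type*) [Field K] (q : ℕ) : Set (Set (Pt K)) :=
  {ℓ | ∃ L : Submodule K (Fin 4 → K), Module.finrank K L = 2 ∧
    (∀ x ∈ L, ∀ y ∈ L, hermForm q x y = 0) ∧ ℓ = pointsOf L}

/-- The points of the embedded `W(3, q)`: the points of `PG(3, q²)` having a nonzero coordinate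
vector over `F = GF(q)`. On such vectors (in characteristic two) the Hermitian form restricts to an
alternating form, so all these points are points of `W(3, q)` and of `H(3, q²)`. -/
def sympPoints (F K : Type*) [Field F] [Field K] [Algebra F K] : Set (Pt K) :=
  {p | ∃ v : Fin 4 → F, v ≠ 0 ∧ (fun i => algebraMap F K (v i)) ∈ p.submodule}

/-- The external points: points of `H(3, q²)` not in `W(3, q)`. -/
def extPoints (F K : Type*) [Field F] [Field K] [Algebra F K] (q : ℕ) : Set (Pt K) :=
  hermPoints K q \ sympPoints F K

/-- The external lines: lines of `H(3, q²)` disjoint from `W(3, q)`. -/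
def extLines (F K : Type*) [Field F] [Field K] [Algebra F K] (q : ℕ) : Set (Set (Pt K)) :=
  {ℓ ∈ hermLines K q | Disjoint ℓ (sympPoints F K)}

/-- A relative hemisystem of `H(3, q²)` with respect to `W(3, q)`: a set of external lines
containing exactly half of the external lines through each external point. -/
def IsRelativeHemisystem (F K : Type*) [Field F] [Field K] [Algebra F K] (q : ℕ)
    (R : Set (Set (Pt K))) : Prop :=
  R ⊆ extLines F K q ∧ ∀ P ∈ extPoints F K q,
    2 * {ℓ ∈ R | P ∈ ℓ}.ncard = {ℓ ∈ extLines F K q | P ∈ ℓ}.ncard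

/-! ### Collineation groups -/

/-- The collineation group of `H(3, q²)`: the permutations of the points of `PG(3, q²)` that
preserve the set of lines of `PG(3, q²)` and the set of points of `H(3, q²)`. -/
def PGammaU (K : Type*) [Field K] (q : ℕ) : Subgroup (Equiv.Perm (Pt K)) :=
  MulAction.stabilizer (Equiv.Perm (Pt K)) (projLines K) ⊓
    MulAction.stabilizer (Equiv.Perm (Pt K)) (hermPoints K q)

/-- The group `GU(4, q)` of isometries of the Hermitian form. -/
def GU (K : Type*) [Field K] (q : ℕ) : Subgroup (GL (Fin 4) K) where
  carrier := {A | ∀ x y, hermForm q (A.val *ᵥ x) (A.val *ᵥ y) = hermForm q x y}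
  mul_mem' := by
    intro A B hA hB x y
    change ∀ x y, _ = _ at hA hB
    rw [Units.val_mul, ← Matrix.mulVec_mulVec, ← Matrix.mulVec_mulVec, hA, hB]
  one_mem' := by intro x y; simp
  inv_mem' := by
    intro A hA x y
    change ∀ x y, _ = _ at hA
    rw [← hA (A⁻¹.val *ᵥ x), Matrix.mulVec_mulVec, Matrix.mulVec_mulVec, Units.mul_inv,
      Matrix.one_mulVec, Matrix.one_mulVec]

/-- The group `PGU(4, q)`, acting on the points of `PG(3, q²)`. -/
def PGU (K : Type*) [Field K] (q : ℕ) : Subgroup (Equiv.Perm (Pt K)) :=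
  (GU K q).map (MulAction.toPermHom (GL (Fin 4) K) (Pt K))

/-- The quadratic form `x₁² + δ x₂² + x₁ x₂ + x₃ x₄`. -/
def quadForm {R : Type*} [CommRing R] (δ : R) (x : Fin 4 → R) : R :=
  x 0 ^ 2 + δ * x 1 ^ 2 + x 0 * x 1 + x 2 * x 3

/-- The special orthogonal group of the form `quadForm δ` over `F`: the isometries of determinant
one. When the form is elliptic and `F = GF(q)`, this is `SO⁻(4, q)`. -/
def SO {F : Type*} [Field F] (δ : F) : Subgroup (GL (Fin 4) F) where
  carrier := {A | A.val.det = 1 ∧ ∀ x, quadForm δ (A.val *ᵥ x) = quadForm δ x}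
  mul_mem' := by
    rintro A B ⟨hA, hA'⟩ ⟨hB, hB'⟩
    refine ⟨by rw [Units.val_mul, Matrix.det_mul, hA, hB, mul_one], fun x => ?_⟩
    rw [Units.val_mul, ← Matrix.mulVec_mulVec, hA', hB']
  one_mem' := by simp
  inv_mem' := by
    rintro A ⟨hA, hA'⟩
    refine ⟨?_, fun x => ?_⟩
    · have h : (A.val * A⁻¹.val).det = 1 := by rw [Units.mul_inv, Matrix.det_one]
      rwa [Matrix.det_mul, hA, one_mul] at h
    · rw [← hA' (A⁻¹.val *ᵥ x), Matrix.mulVec_mulVec, Units.mul_inv, Matrix.one_mulVec]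

/-- The reflection `x ↦ x - (B(x, v) / Q(v)) v` of the form `Q = quadForm δ` with polar form `B`
(an orthogonal transvection in characteristic two); it is used for `Q(v) ≠ 0`. -/
def reflection {F : Type*} [Field F] (δ : F) (v x : Fin 4 → F) : Fin 4 → F :=
  x - (QuadraticMap.polar (quadForm δ) x v / quadForm δ v) • v

/-- The group generated by the products of two reflections, that is, the group of all products of
an even number of reflections. When the form is elliptic and `F = GF(q)` with `q` even, this is
`Ω⁻(4, q)`. -/
def Omega {F : Type*} [Field F] (δ : F) : Subgroup (GL (Fin 4) F) :=
  Subgroup.closure {A | ∃ v w : Fin 4 → F, quadForm δ v ≠ 0 ∧ quadForm δ w ≠ 0 ∧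
    ∀ x, A.val *ᵥ x = reflection δ v (reflection δ w x)}

/-- The action on the points of `PG(3, K)` of the invertible matrices over a subfield `F`. -/
noncomputable def subfieldAction (F K : Type*) [Field F] [Field K] [Algebra F K] :
    GL (Fin 4) F →* Equiv.Perm (Pt K) :=
  (MulAction.toPermHom (GL (Fin 4) K) (Pt K)).comp
    (Matrix.GeneralLinearGroup.map (algebraMap F K))

/-- `PSO⁻(4, q)`, acting on the points of `PG(3, q²)`. -/
noncomputable def PSO {F : Type*} (K : Type*) [Field F] [Field K] [Algebra F K] (δ : F) :
    Subgroup (Equiv.Perm (Pt K)) :=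
  (SO δ).map (subfieldAction F K)

/-- `PΩ⁻(4, q)`, acting on the points of `PG(3, q²)`. -/
noncomputable def POmega {F : Type*} (K : Type*) [Field F] [Field K] [Algebra F K] (δ : F) :
    Subgroup (Equiv.Perm (Pt K)) :=
  (Omega δ).map (subfieldAction F K)

/-! ### The hyperbolic quadric and its reguli -/

/-- The points of the quadric `x₁² + δ x₂² + x₁ x₂ + x₃ x₄ = 0` of `PG(3, K)`. -/
def quadricPoints {K : Type*} [Field K] (δ : K) : Set (Pt K) :=
  {p | ∀ v ∈ p.submodule, quadForm δ v = 0}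

/-- The first regulus of the hyperbolic quadric with `δ = υ^(q+1)`, where `υ^q + υ = 1`. -/
def regulus₁ {K : Type*} [Field K] (q : ℕ) (υ : K) : Set (Set (Pt K)) :=
  Set.range (fun l : K => lineThrough ![υ ^ q, 1, 0, l] ![l * υ, l, 1, 0]) ∪
    {lineThrough ![0, 0, 0, 1] ![υ, 1, 0, 0]}

/-- The second (opposite) regulus of the same quadric. -/
def regulus₂ {K : Type*} [Field K] (q : ℕ) (υ : K) : Set (Set (Pt K)) :=
  Set.range (fun l : K => lineThrough ![υ ^ q, 1, l, 0] ![l * υ, l, 0, 1]) ∪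
    {lineThrough ![0, 0, 1, 0] ![υ, 1, 0, 0]}

/-! ### The criteria for relative hemisystems -/

/-- `Γ` acts semiregularly on the subset `S` of a `Γ`-set: the elements of `Γ` fixing some element
of `S` are in the kernel of the action, i.e. fix every element of `S`. -/
def ActsSemiregularly {Γ X : Type*} [Group Γ] [MulAction Γ X] (G : Subgroup Γ) (S : Set X) :
    Prop :=
  ∀ g ∈ G, (∃ x ∈ S, g • x = x) → ∀ x ∈ S, g • x = x

/-- The set `S / G` of orbits of `G` on `S`. -/
def orbitsOn {Γ X : Type*} [Group Γ] [MulAction Γ X] (G : Subgroup Γ) (S : Set X) : Set (Set X) :=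
  {O | ∃ x ∈ S, O = MulAction.orbit G x}

/-- The conditions under which the pair `(G, G')` determines relative hemisystems: `G < G'` are
groups of collineations of `H(3, q²)` stabilising `W(3, q)`, with `|G' : G| = 2`; `G'` acts
semiregularly on the `G`-orbits of external lines; and `G`, `G'` have the same orbits on external
points. The kernel of the action on the `G`-orbits of external lines is required to be `G`, so that
an element of `G'` outside `G` fixes no such orbit. -/
structure IndexTwoCriterion (F K : Type*) [Field F] [Field K] [Algebra F K] (q : ℕ)
    (G G' : Subgroup (Equiv.Perm (Pt K))) : Prop where
  lt : G < G'
  le_collineations : G' ≤ PGammaU K q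
  stabilises_W : ∀ g ∈ G', g • sympPoints F K = sympPoints F K
  index_two : G.relIndex G' = 2
  semiregular : ActsSemiregularly G' (orbitsOn G (extLines F K q))
  kernel : ∀ g ∈ G', (∀ O ∈ orbitsOn G (extLines F K q), g • O = O) ↔ g ∈ G
  orbits_eq : orbitsOn G' (extPoints F K q) = orbitsOn G (extPoints F K q)

/-- The criterion for a subgroup `G'` of `PSO⁻(4, q)` and `G = G' ∩ PΩ⁻(4, q)`: the stabiliser in
`G'` of every external point is not contained in `PΩ⁻(4, q)`. -/
structure PointStabiliserCriterion {F : Type*} (K : Type*) [Field F] [Field K] [Algebra F K]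
    (q : ℕ) (δ : F) (G G' : Subgroup (Equiv.Perm (Pt K))) : Prop where
  le_PSO : G' ≤ PSO K δ
  eq_inf : G = G' ⊓ POmega K δ
  stabiliser : ∀ P ∈ extPoints F K q,
    ¬ (G' ⊓ MulAction.stabilizer (Equiv.Perm (Pt K)) P ≤ POmega K δ)

/-- `R` is determined by the pair `(G, G')`: it is the union of the `G`-orbits of a set `T` of
representatives of the `G'`-orbits on external lines. -/
def DeterminedBy (F K : Type*) [Field F] [Field K] [Algebra F K] (q : ℕ)
    (G G' : Subgroup (Equiv.Perm (Pt K))) (R : Set (Set (Pt K))) : Prop :=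
  ∃ T ⊆ extLines F K q,
    (∀ ℓ ∈ extLines F K q, ∃! m, m ∈ T ∧ m ∈ MulAction.orbit G' ℓ) ∧
    R = ⋃ ℓ ∈ T, MulAction.orbit G ℓ

/-- The Penttila–Williford family on `H(3, q²)`: the orbits of `PΩ⁻(4, q)` on external lines. -/
noncomputable def pwFamily {F : Type*} (K : Type*) [Field F] [Field K] [Algebra F K] (q : ℕ)
    (δ : F) : Set (Set (Set (Pt K))) :=
  orbitsOn (POmega K δ) (extLines F K q)

end RelHemi

/-! Write Q for the quadratic form, B for its polar form and x̄ for the coordinatewise q-th power of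
x. The Hermitian form is B(x, ȳ), so an isometry of Q with entries in GF(q) is also a Hermitian
isometry.

The central notion is the parity of an isometry. Over GF(q²) the form Q is hyperbolic, and every
reflection interchanges its two rulings (`reflectionGL_smul_ruling₁`, `reflectionGL_smul_ruling₂`).
Over GF(q) it has Witt index one, and a Cartan–Dieudonné argument shows that reflections generate
all isometries (`SO_le_reflectionGroup`). Hence PΩ⁻ has index two in PSO⁻ and consists of the
elements that fix a ruling (`mem_POmega_iff`).

An external line L is anisotropic for Q (`quadForm_ne_zero`), and the whole space is the orthogonal
sum of L and L̄. A basis x, y of L can be normalised to Q(x) = B(x, y) = 1; then Q(y) avoids the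
values s² + s. Two such values differ by some s² + s, so bases of two external lines can be matched
by an isometry that commutes with conjugation: PSO⁻ is transitive on external lines
(`exists_mem_PSO_smul_eq`). An element stabilising L is undone by pairs of reflections in v and v̄
with v in L, so it is even (`mem_POmega_of_smul_eq`). An external point spanned by a + υb has B(a,
b) = 0 and a or b nonsingular; reflection in that vector fixes the point
(`exists_reflection_smul_eq`).

So PΩ⁻ has exactly two orbits on external lines, exchanged by every odd element
(`IndexTwoTransitive`). An odd reflection fixing P exchanges the lines through P in the two orbits,
which gives the hemisystem property.

For the stabiliser of the quadric in PGU(4, q) (`PSO_eq`), a matrix preserving the zeros of Q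
satisfies Q(Ax) = cQ(x). Combined with Hermitian invariance this makes A commute with conjugation up
to the scalar c, and a multiple of A then has entries in GF(q). -/

namespace RelHemi

/-! ### The quadratic form and its polarisation in characteristic two -/

section Forms

variable {R : Type*} [CommRing R]

/-- The alternating form obtained by polarising `quadForm δ` in characteristic two. -/
def polarForm (x y : Fin 4 → R) : R := x 0 * y 1 + x 1 * y 0 + x 2 * y 3 + x 3 * y 2

lemma polarForm_add_left (x y z : Fin 4 → R) :
    polarForm (x + y) z = polarForm x z + polarForm y z := by
  simp only [polarForm, Pi.add_apply]; ring

lemma polarForm_add_right (x y z : Fin 4 → R) :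
    polarForm x (y + z) = polarForm x y + polarForm x z := by
  simp only [polarForm, Pi.add_apply]; ring

lemma polarForm_smul_left (c : R) (x y : Fin 4 → R) :
    polarForm (c • x) y = c * polarForm x y := by
  simp only [polarForm, Pi.smul_apply, smul_eq_mul]; ring

lemma polarForm_smul_right (c : R) (x y : Fin 4 → R) :
    polarForm x (c • y) = c * polarForm x y := by
  simp only [polarForm, Pi.smul_apply, smul_eq_mul]; ring

lemma polarForm_comm (x y : Fin 4 → R) : polarForm x y = polarForm y x := by
  simp only [polarForm]; ring

lemma quadForm_smul (δ c : R) (x : Fin 4 → R) : quadForm δ (c • x) = c ^ 2 * quadForm δ x := by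
  simp only [quadForm, Pi.smul_apply, smul_eq_mul]; ring

lemma quadForm_zero (δ : R) : quadForm δ (0 : Fin 4 → R) = 0 := by
  simp [quadForm]

variable [CharP R 2]

lemma polarForm_self (x : Fin 4 → R) : polarForm x x = 0 := by
  simp only [polarForm]
  linear_combination (x 0 * x 1 + x 2 * x 3) * (CharTwo.two_eq_zero : (2 : R) = 0)

lemma quadForm_add (δ : R) (x y : Fin 4 → R) :
    quadForm δ (x + y) = quadForm δ x + quadForm δ y + polarForm x y := by
  simp only [quadForm, polarForm, Pi.add_apply]
  linear_combination (x 0 * y 0 + δ * x 1 * y 1) * (CharTwo.two_eq_zero : (2 : R) = 0)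

lemma polar_quadForm (δ : R) (x y : Fin 4 → R) :
    QuadraticMap.polar (quadForm δ) x y = polarForm x y := by
  rw [QuadraticMap.polar, quadForm_add]; ring

/-- Maps preserving `quadForm` additively preserve its polarisation. -/
lemma polarForm_of_quadForm {δ : R} {A : Matrix (Fin 4) (Fin 4) R}
    (hA : ∀ x, quadForm δ (A *ᵥ x) = quadForm δ x) (x y : Fin 4 → R) :
    polarForm (A *ᵥ x) (A *ᵥ y) = polarForm x y := by
  have h := hA (x + y)
  rw [Matrix.mulVec_add, quadForm_add, quadForm_add, hA, hA] at h
  exact add_left_cancel h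

end Forms

/-! ### Reflections and their matrices -/

section Reflections

variable {K : Type*} [Field K] [CharP K 2]

lemma reflection_eq (δ : K) (v x : Fin 4 → K) :
    reflection δ v x = x + (polarForm x v / quadForm δ v) • v := by
  rw [reflection, polar_quadForm, CharTwo.sub_eq_add]

lemma reflection_of_polarForm_eq_zero (δ : K) {v x : Fin 4 → K} (h : polarForm x v = 0) :
    reflection δ v x = x := by
  simp [reflection_eq, h]

lemma quadForm_reflection {δ : K} {v : Fin 4 → K} (hv : quadForm δ v ≠ 0) (x : Fin 4 → K) :
    quadForm δ (reflection δ v x) = quadForm δ x := by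
  rw [reflection_eq, quadForm_add, quadForm_smul, polarForm_smul_right]
  field_simp
  linear_combination (polarForm x v) ^ 2 * (CharTwo.two_eq_zero : (2 : K) = 0)

lemma reflection_reflection {δ : K} {v : Fin 4 → K} (x : Fin 4 → K) :
    reflection δ v (reflection δ v x) = x := by
  rw [reflection_eq δ v x, reflection_eq, polarForm_add_left, polarForm_smul_left, polarForm_self,
    mul_zero, add_zero, add_assoc, CharTwo.add_self_eq_zero, add_zero]

/-- A reflection interchanges two vectors of equal norm whose difference is nonsingular. -/
lemma reflection_add_left {δ : K} {u w : Fin 4 → K} (h : quadForm δ u = quadForm δ w)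
    (hv : quadForm δ (u + w) ≠ 0) : reflection δ (u + w) u = w := by
  have h2 : polarForm u (u + w) = quadForm δ (u + w) := by
    rw [quadForm_add, h, CharTwo.add_self_eq_zero, polarForm_add_right, polarForm_self]
  rw [reflection_eq, h2, div_self hv, one_smul, ← add_assoc, CharTwo.add_self_eq_zero, zero_add]

/-- The matrix of a reflection. -/
noncomputable def reflectionMatrix (δ : K) (v : Fin 4 → K) : Matrix (Fin 4) (Fin 4) K :=
  1 + (quadForm δ v)⁻¹ • Matrix.vecMulVec v ![v 1, v 0, v 3, v 2]

lemma reflectionMatrix_mulVec (δ : K) (v x : Fin 4 → K) :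
    reflectionMatrix δ v *ᵥ x = reflection δ v x := by
  rw [reflection_eq, reflectionMatrix, Matrix.add_mulVec, Matrix.one_mulVec, Matrix.smul_mulVec,
    Matrix.vecMulVec_mulVec]
  congr 1
  ext i
  simp [dotProduct, Fin.sum_univ_four, polarForm]
  ring

/-- A reflection as an invertible matrix. -/
noncomputable def reflectionGL (δ : K) (v : Fin 4 → K) : GL (Fin 4) K :=
  have h : reflectionMatrix δ v * reflectionMatrix δ v = 1 := by
    refine Matrix.ext_of_mulVec_single fun i => ?_
    rw [← Matrix.mulVec_mulVec, reflectionMatrix_mulVec, reflectionMatrix_mulVec,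
      reflection_reflection, Matrix.one_mulVec]
  ⟨reflectionMatrix δ v, reflectionMatrix δ v, h, h⟩

lemma reflectionGL_mulVec (δ : K) (v x : Fin 4 → K) :
    (reflectionGL δ v).val *ᵥ x = reflection δ v x :=
  reflectionMatrix_mulVec δ v x

lemma reflectionGL_mul_self (δ : K) (v : Fin 4 → K) :
    reflectionGL δ v * reflectionGL δ v = 1 :=
  Units.ext (reflectionGL δ v).val_inv

end Reflections

/-! ### The action of matrices on points and subspaces -/

section Action

variable {K : Type*} [Field K]

/-- The action of `GL(4, K)` on the points of `PG(3, K)`. -/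
noncomputable abbrev act : GL (Fin 4) K →* Equiv.Perm (Pt K) :=
  MulAction.toPermHom (GL (Fin 4) K) (Pt K)

lemma submodule_act (A : GL (Fin 4) K) (p : Pt K) :
    (act A • p).submodule = p.submodule.map A.val.mulVecLin := by
  induction p using Projectivization.ind with | _ v hv =>
  change (A • Projectivization.mk K v hv).submodule = _
  rw [Projectivization.smul_mk, Projectivization.submodule_mk, Projectivization.submodule_mk,
    Submodule.map_span, Set.image_singleton]
  rfl

lemma mulVec_injective (A : GL (Fin 4) K) : Function.Injective A.val.mulVecLin := by
  intro x y h
  have := congrArg (A⁻¹.val *ᵥ ·) h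
  simpa [Matrix.mulVec_mulVec] using this

lemma mulVecLin_inv_apply (A : GL (Fin 4) K) (x : Fin 4 → K) :
    A.val *ᵥ (A⁻¹.val *ᵥ x) = x := by
  rw [Matrix.mulVec_mulVec, Units.mul_inv, Matrix.one_mulVec]

lemma smul_pointsOf (A : GL (Fin 4) K) (L : Submodule K (Fin 4 → K)) :
    act A • pointsOf L = pointsOf (L.map A.val.mulVecLin) := by
  ext p
  obtain ⟨p, rfl⟩ := (MulAction.surjective (act A)) p
  simp only [Set.smul_mem_smul_set_iff]
  change p.submodule ≤ L ↔ (act A • p).submodule ≤ _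
  rw [submodule_act]
  exact (Submodule.map_le_map_iff_of_injective (mulVec_injective A) _ _).symm

lemma mk_mem_pointsOf {L : Submodule K (Fin 4 → K)} {v : Fin 4 → K} (hv : v ≠ 0) :
    Projectivization.mk K v hv ∈ pointsOf L ↔ v ∈ L := by
  change (Projectivization.mk K v hv).submodule ≤ L ↔ _
  rw [Projectivization.submodule_mk, Submodule.span_singleton_le_iff_mem]

lemma pointsOf_injective : Function.Injective (pointsOf (K := K)) := by
  intro L M h
  ext v
  by_cases hv : v = 0
  · simp [hv]
  · rw [← mk_mem_pointsOf hv, h, mk_mem_pointsOf hv]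

/-- An invertible matrix preserving membership of a set of vectors induces a permutation
stabilising the corresponding set of points. -/
lemma smul_setOf_forall (A : GL (Fin 4) K) {S T : (Fin 4 → K) → Prop}
    (h : ∀ v, T (A.val *ᵥ v) ↔ S v) :
    act A • {p : Pt K | ∀ v ∈ p.submodule, S v} = {p : Pt K | ∀ v ∈ p.submodule, T v} := by
  ext p
  obtain ⟨p, rfl⟩ := (MulAction.surjective (act A)) p
  simp only [Set.smul_mem_smul_set_iff, Set.mem_ofPred_eq]
  rw [submodule_act]
  simp [Submodule.mem_map, h]

end Action

/-! ### The two rulings of the hyperbolic quadric -/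

section Rulings

variable {K : Type*} [Field K] [CharP K 2]

/-- The lines of the first ruling of the quadric. -/
def rulingLine₁ (υ a b : K) : Submodule K (Fin 4 → K) where
  carrier := {x | a * (x 0 + υ * x 1) + b * x 3 = 0 ∧ a * x 2 + b * (x 0 + (υ + 1) * x 1) = 0}
  add_mem' := by
    rintro x y ⟨h1, h2⟩ ⟨h3, h4⟩
    simp only [Set.mem_ofPred_eq, Pi.add_apply]
    exact ⟨by linear_combination h1 + h3, by linear_combination h2 + h4⟩
  zero_mem' := by simp
  smul_mem' := by
    rintro c x ⟨h1, h2⟩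
    simp only [Set.mem_ofPred_eq, Pi.smul_apply, smul_eq_mul]
    exact ⟨by linear_combination c * h1, by linear_combination c * h2⟩

/-- The lines of the second ruling of the quadric. -/
def rulingLine₂ (υ a b : K) : Submodule K (Fin 4 → K) where
  carrier := {x | a * (x 0 + υ * x 1) + b * x 2 = 0 ∧ a * x 3 + b * (x 0 + (υ + 1) * x 1) = 0}
  add_mem' := by
    rintro x y ⟨h1, h2⟩ ⟨h3, h4⟩
    simp only [Set.mem_ofPred_eq, Pi.add_apply]
    exact ⟨by linear_combination h1 + h3, by linear_combination h2 + h4⟩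
  zero_mem' := by simp
  smul_mem' := by
    rintro c x ⟨h1, h2⟩
    simp only [Set.mem_ofPred_eq, Pi.smul_apply, smul_eq_mul]
    exact ⟨by linear_combination c * h1, by linear_combination c * h2⟩

omit [CharP K 2] in
lemma mem_rulingLine₁ {υ a b : K} {x : Fin 4 → K} : x ∈ rulingLine₁ υ a b ↔
    a * (x 0 + υ * x 1) + b * x 3 = 0 ∧ a * x 2 + b * (x 0 + (υ + 1) * x 1) = 0 := Iff.rfl

omit [CharP K 2] in
lemma mem_rulingLine₂ {υ a b : K} {x : Fin 4 → K} : x ∈ rulingLine₂ υ a b ↔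
    a * (x 0 + υ * x 1) + b * x 2 = 0 ∧ a * x 3 + b * (x 0 + (υ + 1) * x 1) = 0 := Iff.rfl

omit [CharP K 2] in
lemma rulingLine₁_smul (υ a b : K) {c : K} (hc : c ≠ 0) :
    rulingLine₁ υ (c * a) (c * b) = rulingLine₁ υ a b := by
  ext x
  simp only [mem_rulingLine₁, mul_assoc, ← mul_add, mul_eq_zero, hc, false_or]

omit [CharP K 2] in
lemma rulingLine₂_smul (υ a b : K) {c : K} (hc : c ≠ 0) :
    rulingLine₂ υ (c * a) (c * b) = rulingLine₂ υ a b := by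
  ext x
  simp only [mem_rulingLine₂, mul_assoc, ← mul_add, mul_eq_zero, hc, false_or]

/-- With ℓ = v 0 + υ v 1 and m = v 0 + (υ + 1) v 1 the form factors as Q(v) = ℓm + v 2 v 3. The new
parameters are the image of (a, b) under the matrix with rows (v 2, m) and (ℓ, v 3), whose
determinant is Q(v). Besides the equations of the line, only tQ(v) = B(x, v) for the reflection
coefficient t is needed. -/
lemma reflection_mem_rulingLine₂ {υ a b : K} {v x : Fin 4 → K}
    (hv : quadForm (υ * (υ + 1)) v ≠ 0) (hx : x ∈ rulingLine₁ υ a b) :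
    reflection (υ * (υ + 1)) v x ∈ rulingLine₂ υ (b * (v 0 + (υ + 1) * v 1) + a * v 2)
      (b * v 3 + a * (v 0 + υ * v 1)) := by
  obtain ⟨h1, h2⟩ := hx
  have h0 : (2 : K) = 0 := CharTwo.two_eq_zero
  have ht : polarForm x v / quadForm (υ * (υ + 1)) v * quadForm (υ * (υ + 1)) v = polarForm x v :=
    div_mul_cancel₀ _ hv
  rw [reflection_eq]
  generalize polarForm x v / quadForm (υ * (υ + 1)) v = t at ht
  simp only [quadForm, polarForm] at ht
  simp only [mem_rulingLine₂, Pi.add_apply, Pi.smul_apply, smul_eq_mul]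
  constructor
  · linear_combination v 2 * h1 + (v 0 + υ * v 1) * h2 + b * ht +
      (b * (v 1 * x 0 + v 3 * x 2) + t * a * v 2 * (v 0 + υ * v 1) + υ * v 0 * v 1 * t * b) * h0
  · linear_combination (v 0 + (υ + 1) * v 1) * h1 + v 3 * h2 + a * ht +
      (a * (v 2 * x 3 + v 0 * x 1) + t * b * v 3 * (v 0 + (υ + 1) * v 1) +
        υ * v 0 * v 1 * t * a) * h0

lemma reflection_mem_rulingLine₁ {υ a b : K} {v x : Fin 4 → K}
    (hv : quadForm (υ * (υ + 1)) v ≠ 0) (hx : x ∈ rulingLine₂ υ a b) :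
    reflection (υ * (υ + 1)) v x ∈ rulingLine₁ υ (b * (v 0 + (υ + 1) * v 1) + a * v 3)
      (b * v 2 + a * (v 0 + υ * v 1)) := by
  obtain ⟨h1, h2⟩ := hx
  have h0 : (2 : K) = 0 := CharTwo.two_eq_zero
  have ht : polarForm x v / quadForm (υ * (υ + 1)) v * quadForm (υ * (υ + 1)) v = polarForm x v :=
    div_mul_cancel₀ _ hv
  rw [reflection_eq]
  generalize polarForm x v / quadForm (υ * (υ + 1)) v = t at ht
  simp only [quadForm, polarForm] at ht
  simp only [mem_rulingLine₁, Pi.add_apply, Pi.smul_apply, smul_eq_mul]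
  constructor
  · linear_combination v 3 * h1 + (v 0 + υ * v 1) * h2 + b * ht +
      (b * (v 1 * x 0 + v 2 * x 3) + t * a * v 3 * (v 0 + υ * v 1) + υ * v 0 * v 1 * t * b) * h0
  · linear_combination (v 0 + (υ + 1) * v 1) * h1 + v 2 * h2 + a * ht +
      (a * (v 3 * x 2 + v 0 * x 1) + t * b * v 2 * (v 0 + (υ + 1) * v 1) +
        υ * v 0 * v 1 * t * a) * h0

/-- The first ruling, as a set of lines. -/
def ruling₁ (υ : K) : Set (Set (Pt K)) :=
  {ℓ | ∃ a b, (a ≠ 0 ∨ b ≠ 0) ∧ ℓ = pointsOf (rulingLine₁ υ a b)}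

/-- The second ruling, as a set of lines. -/
def ruling₂ (υ : K) : Set (Set (Pt K)) :=
  {ℓ | ∃ a b, (a ≠ 0 ∨ b ≠ 0) ∧ ℓ = pointsOf (rulingLine₂ υ a b)}

lemma map_rulingLine₁ {υ a b : K} {v : Fin 4 → K} (hv : quadForm (υ * (υ + 1)) v ≠ 0) :
    (rulingLine₁ υ a b).map (reflectionGL (υ * (υ + 1)) v).val.mulVecLin =
      rulingLine₂ υ (b * (v 0 + (υ + 1) * v 1) + a * v 2) (b * v 3 + a * (v 0 + υ * v 1)) := by
  ext y
  simp only [Submodule.mem_map, Matrix.mulVecLin_apply, reflectionGL_mulVec]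
  constructor
  · rintro ⟨x, hx, rfl⟩
    exact reflection_mem_rulingLine₂ hv hx
  · intro hy
    refine ⟨reflection (υ * (υ + 1)) v y, ?_, reflection_reflection y⟩
    have h := reflection_mem_rulingLine₁ hv hy
    -- Composing the two parameter maps multiplies (a, b) by Q(v), which does not change the line.
    rw [← rulingLine₁_smul υ a b hv]
    convert h using 1
    have h0 : (2 : K) = 0 := CharTwo.two_eq_zero
    congr 1
    · simp only [quadForm]
      linear_combination (-(υ * v 0 * v 1 * a) - b * v 3 * (v 0 + (υ + 1) * v 1)) * h0
    · simp only [quadForm]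
      linear_combination (-(υ * v 0 * v 1 * b) - a * v 2 * (v 0 + υ * v 1)) * h0

lemma map_rulingLine₂ {υ a b : K} {v : Fin 4 → K} (hv : quadForm (υ * (υ + 1)) v ≠ 0) :
    (rulingLine₂ υ a b).map (reflectionGL (υ * (υ + 1)) v).val.mulVecLin =
      rulingLine₁ υ (b * (v 0 + (υ + 1) * v 1) + a * v 3) (b * v 2 + a * (v 0 + υ * v 1)) := by
  ext y
  simp only [Submodule.mem_map, Matrix.mulVecLin_apply, reflectionGL_mulVec]
  constructor
  · rintro ⟨x, hx, rfl⟩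
    exact reflection_mem_rulingLine₁ hv hx
  · intro hy
    refine ⟨reflection (υ * (υ + 1)) v y, ?_, reflection_reflection y⟩
    have h := reflection_mem_rulingLine₂ hv hy
    rw [← rulingLine₂_smul υ a b hv]
    convert h using 1
    have h0 : (2 : K) = 0 := CharTwo.two_eq_zero
    congr 1
    · simp only [quadForm]
      linear_combination (-(υ * v 0 * v 1 * a) - b * v 2 * (v 0 + (υ + 1) * v 1)) * h0
    · simp only [quadForm]
      linear_combination (-(υ * v 0 * v 1 * b) - a * v 3 * (v 0 + υ * v 1)) * h0

/-- An invertible two by two matrix (with determinant the value of `quadForm`) has no kernel. -/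
lemma coefficients_ne_zero {υ a b n : K} {v : Fin 4 → K} {i j : Fin 4}
    (hv : (v 0 + (υ + 1) * v 1) * (v 0 + υ * v 1) + v i * v j = n) (hn : n ≠ 0)
    (h : a ≠ 0 ∨ b ≠ 0) :
    b * (v 0 + (υ + 1) * v 1) + a * v i ≠ 0 ∨ b * v j + a * (v 0 + υ * v 1) ≠ 0 := by
  by_contra! hc
  obtain ⟨h1, h2⟩ := hc
  have h0 : (2 : K) = 0 := CharTwo.two_eq_zero
  have hb : n * b = 0 := by
    linear_combination -b * hv + (v 0 + υ * v 1) * h1 + v i * h2 - (a * v i * (v 0 + υ * v 1)) * h0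
  have ha : n * a = 0 := by
    linear_combination -a * hv + v j * h1 + (v 0 + (υ + 1) * v 1) * h2 -
      (b * v j * (v 0 + (υ + 1) * v 1)) * h0
  simp_all

lemma reflectionGL_smul_ruling₁_le {υ : K} {v : Fin 4 → K} (hv : quadForm (υ * (υ + 1)) v ≠ 0) :
    act (reflectionGL (υ * (υ + 1)) v) • ruling₁ υ ⊆ ruling₂ υ := by
  rintro _ ⟨_, ⟨a, b, hab, rfl⟩, rfl⟩
  refine ⟨_, _, coefficients_ne_zero (i := 2) (j := 3) ?_ hv hab,
    (smul_pointsOf _ _).trans (congrArg _ (map_rulingLine₁ hv))⟩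
  simp only [quadForm]
  linear_combination υ * v 0 * v 1 * (CharTwo.two_eq_zero : (2 : K) = 0)

lemma reflectionGL_smul_ruling₂_le {υ : K} {v : Fin 4 → K} (hv : quadForm (υ * (υ + 1)) v ≠ 0) :
    act (reflectionGL (υ * (υ + 1)) v) • ruling₂ υ ⊆ ruling₁ υ := by
  rintro _ ⟨_, ⟨a, b, hab, rfl⟩, rfl⟩
  refine ⟨_, _, coefficients_ne_zero (i := 3) (j := 2) ?_ hv hab,
    (smul_pointsOf _ _).trans (congrArg _ (map_rulingLine₂ hv))⟩
  simp only [quadForm]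
  linear_combination υ * v 0 * v 1 * (CharTwo.two_eq_zero : (2 : K) = 0)

lemma act_reflectionGL_smul_smul {X : Type*} [MulAction (Equiv.Perm (Pt K)) X] (δ : K)
    (v : Fin 4 → K) (x : X) : act (reflectionGL δ v) • act (reflectionGL δ v) • x = x := by
  rw [smul_smul, ← map_mul, reflectionGL_mul_self, map_one, one_smul]

/-- Reflections interchange the two rulings. -/
lemma reflectionGL_smul_ruling₁ {υ : K} {v : Fin 4 → K} (hv : quadForm (υ * (υ + 1)) v ≠ 0) :
    act (reflectionGL (υ * (υ + 1)) v) • ruling₁ υ = ruling₂ υ := by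
  refine (reflectionGL_smul_ruling₁_le hv).antisymm ?_
  rw [← act_reflectionGL_smul_smul (υ * (υ + 1)) v (ruling₂ υ)]
  exact Set.smul_set_mono (reflectionGL_smul_ruling₂_le hv)

/-- Reflections interchange the two rulings. -/
lemma reflectionGL_smul_ruling₂ {υ : K} {v : Fin 4 → K} (hv : quadForm (υ * (υ + 1)) v ≠ 0) :
    act (reflectionGL (υ * (υ + 1)) v) • ruling₂ υ = ruling₁ υ := by
  rw [← reflectionGL_smul_ruling₁ hv, act_reflectionGL_smul_smul]

/-- The line with parameters (1, 0) of the first ruling contains (0, 0, 0, 1) and (υ, 1, 0, 0); on a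
line of the second ruling the first of these forces a = 0 and the second b = 0. This is what
separates odd elements from even ones. -/
lemma ruling₁_ne_ruling₂ (υ : K) : ruling₁ υ ≠ ruling₂ υ := by
  intro h
  have h1 : pointsOf (rulingLine₁ υ 1 0) ∈ ruling₂ υ := h ▸ ⟨1, 0, by simp, rfl⟩
  obtain ⟨a, b, hab, h2⟩ := h1
  replace h2 := pointsOf_injective h2
  have m1 : (![0, 0, 0, 1] : Fin 4 → K) ∈ rulingLine₂ υ a b := h2 ▸ by simp [mem_rulingLine₁]
  have m2 : (![υ, 1, 0, 0] : Fin 4 → K) ∈ rulingLine₂ υ a b :=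
    h2 ▸ by simp [mem_rulingLine₁, CharTwo.add_self_eq_zero]
  simp [mem_rulingLine₂, CharTwo.add_self_eq_zero, ← add_assoc] at m1 m2
  simp_all

/-- The reguli of the statement are the two rulings. -/
lemma regulus₁_eq {q : ℕ} {υ : K} (h : υ ^ q = υ + 1) : regulus₁ q υ = ruling₁ υ := by
  have h0 : (2 : K) = 0 := CharTwo.two_eq_zero
  have e1 : ∀ l : K, lineThrough ![υ ^ q, 1, 0, l] ![l * υ, l, 1, 0] =
      pointsOf (rulingLine₁ υ l 1) := by
    intro l
    refine congrArg pointsOf (le_antisymm (Submodule.span_le.2 ?_) fun x hx => ?_)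
    · rintro x (rfl | rfl)
      · refine mem_rulingLine₁.2 ⟨?_, ?_⟩
        · simp [h]; linear_combination (l * υ + l) * h0
        · simp [h]; linear_combination (υ + 1) * h0
      · refine mem_rulingLine₁.2 ⟨?_, ?_⟩
        · simp; right; linear_combination (l * υ) * h0
        · simp; linear_combination (l * υ + l) * h0
    · obtain ⟨h1, h2⟩ := hx
      refine Submodule.mem_span_pair.2 ⟨x 0 + υ * x 1, x 2, ?_⟩
      ext i
      fin_cases i
      · simp [h]; linear_combination υ * h2
      · simp [h]; linear_combination h2 - x 1 * h0
      · simp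
      · simp; linear_combination h1 - x 3 * h0
  have e2 : lineThrough ![0, 0, 0, 1] ![υ, 1, 0, 0] = pointsOf (rulingLine₁ υ 1 0) := by
    refine congrArg pointsOf (le_antisymm (Submodule.span_le.2 ?_) fun x hx => ?_)
    · rintro x (rfl | rfl)
      · simp [mem_rulingLine₁]
      · simp [mem_rulingLine₁, CharTwo.add_self_eq_zero]
    · obtain ⟨h1, h2⟩ := hx
      refine Submodule.mem_span_pair.2 ⟨x 3, x 1, ?_⟩
      ext i
      fin_cases i
      · simp; linear_combination h1 - x 0 * h0
      · simp
      · simp; linear_combination - h2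
      · simp
  ext ℓ
  simp only [regulus₁, e1, e2]
  constructor
  · rintro (⟨l, rfl⟩ | rfl)
    · exact ⟨l, 1, by simp, rfl⟩
    · exact ⟨1, 0, by simp, rfl⟩
  · rintro ⟨a, b, hab, rfl⟩
    by_cases hb : b = 0
    · subst hb
      right
      have ha : a ≠ 0 := by simpa using hab
      rw [Set.mem_singleton_iff, ← rulingLine₁_smul υ 1 0 ha, mul_one, mul_zero]
    · left
      refine ⟨a / b, ?_⟩
      simp only
      rw [← rulingLine₁_smul υ (a / b) 1 hb, mul_one, mul_div_cancel₀ _ hb]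

lemma regulus₂_eq {q : ℕ} {υ : K} (h : υ ^ q = υ + 1) : regulus₂ q υ = ruling₂ υ := by
  have h0 : (2 : K) = 0 := CharTwo.two_eq_zero
  have e1 : ∀ l : K, lineThrough ![υ ^ q, 1, l, 0] ![l * υ, l, 0, 1] =
      pointsOf (rulingLine₂ υ l 1) := by
    intro l
    refine congrArg pointsOf (le_antisymm (Submodule.span_le.2 ?_) fun x hx => ?_)
    · rintro x (rfl | rfl)
      · refine mem_rulingLine₂.2 ⟨?_, ?_⟩
        · simp [h]; linear_combination (l * υ + l) * h0
        · simp [h]; linear_combination (υ + 1) * h0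
      · refine mem_rulingLine₂.2 ⟨?_, ?_⟩
        · simp; right; linear_combination (l * υ) * h0
        · simp; linear_combination (l * υ + l) * h0
    · obtain ⟨h1, h2⟩ := hx
      refine Submodule.mem_span_pair.2 ⟨x 0 + υ * x 1, x 3, ?_⟩
      ext i
      fin_cases i
      · simp [h]; linear_combination υ * h2
      · simp [h]; linear_combination h2 - x 1 * h0
      · simp; linear_combination h1 - x 2 * h0
      · simp
  have e2 : lineThrough ![0, 0, 1, 0] ![υ, 1, 0, 0] = pointsOf (rulingLine₂ υ 1 0) := by
    refine congrArg pointsOf (le_antisymm (Submodule.span_le.2 ?_) fun x hx => ?_)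
    · rintro x (rfl | rfl)
      · simp [mem_rulingLine₂]
      · simp [mem_rulingLine₂, CharTwo.add_self_eq_zero]
    · obtain ⟨h1, h2⟩ := hx
      refine Submodule.mem_span_pair.2 ⟨x 2, x 1, ?_⟩
      ext i
      fin_cases i
      · simp; linear_combination h1 - x 0 * h0
      · simp
      · simp
      · simp; linear_combination - h2
  ext ℓ
  simp only [regulus₂, e1, e2]
  constructor
  · rintro (⟨l, rfl⟩ | rfl)
    · exact ⟨l, 1, by simp, rfl⟩
    · exact ⟨1, 0, by simp, rfl⟩
  · rintro ⟨a, b, hab, rfl⟩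
    by_cases hb : b = 0
    · subst hb
      right
      have ha : a ≠ 0 := by simpa using hab
      rw [Set.mem_singleton_iff, ← rulingLine₂_smul υ 1 0 ha, mul_one, mul_zero]
    · left
      refine ⟨a / b, ?_⟩
      simp only
      rw [← rulingLine₂_smul υ (a / b) 1 hb, mul_one, mul_div_cancel₀ _ hb]

end Rulings
end RelHemi

namespace RelHemi

/-! ### Generation of the orthogonal group by reflections -/

section Isometries

variable {F : Type*} [Field F] [CharP F 2] {δ : F}

/-- The Gram matrix of `polarForm`. -/
def gram (R : Type*) [CommRing R] : Matrix (Fin 4) (Fin 4) R :=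
  !![0, 1, 0, 0; 1, 0, 0, 0; 0, 0, 0, 1; 0, 0, 1, 0]

omit [CharP F 2] in
lemma dotProduct_gram_mulVec (x y : Fin 4 → F) : x ⬝ᵥ (gram F *ᵥ y) = polarForm x y := by
  simp [gram, polarForm, dotProduct, Matrix.mulVec, Fin.sum_univ_four]

/-- Invariance of the polar form makes the square of the determinant 1, and in characteristic two 1
is its own only square root. The determinant therefore carries no parity information. -/
lemma det_eq_one_of_isometry {A : Matrix (Fin 4) (Fin 4) F}
    (hA : ∀ x, quadForm δ (A *ᵥ x) = quadForm δ x) : A.det = 1 := by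
  have h1 : Aᵀ * gram F * A = gram F := by
    ext i j
    have key := polarForm_of_quadForm hA (Pi.single i 1) (Pi.single j 1)
    rw [← dotProduct_gram_mulVec, ← dotProduct_gram_mulVec, ← Matrix.vecMul_transpose,
      ← Matrix.dotProduct_mulVec, Matrix.mulVec_mulVec, Matrix.mulVec_mulVec] at key
    simpa [Matrix.mul_assoc] using key
  have h2 : gram F * gram F = 1 := by
    ext i j
    fin_cases i <;> fin_cases j <;> simp [gram, Matrix.mul_apply, Fin.sum_univ_four]
  have h3 : (gram F).det * (gram F).det = 1 := by rw [← Matrix.det_mul, h2, Matrix.det_one]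
  have h4 := congrArg Matrix.det h1
  rw [Matrix.det_mul, Matrix.det_mul, Matrix.det_transpose] at h4
  have h5 : (A.det + 1) ^ 2 = 0 := by
    linear_combination (gram F).det * h4 + (1 - A.det ^ 2) * h3 +
      (1 + A.det) * (CharTwo.two_eq_zero : (2 : F) = 0)
  rw [CharTwo.add_eq_zero.1 (pow_eq_zero_iff two_ne_zero |>.1 h5)]

lemma mem_SO_iff {A : GL (Fin 4) F} : A ∈ SO δ ↔ ∀ x, quadForm δ (A.val *ᵥ x) = quadForm δ x :=
  ⟨fun h => h.2, fun h => ⟨det_eq_one_of_isometry h, h⟩⟩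

/-- A matrix preserving the quadratic form, as an element of the special orthogonal group. -/
lemma exists_mem_SO {A : Matrix (Fin 4) (Fin 4) F}
    (hA : ∀ x, quadForm δ (A *ᵥ x) = quadForm δ x) : ∃ B ∈ SO δ, B.val = A :=
  ⟨Matrix.GeneralLinearGroup.mkOfDetNeZero A (by simp [det_eq_one_of_isometry hA]),
    mem_SO_iff.2 hA, rfl⟩

lemma reflectionGL_mem_SO {v : Fin 4 → F} (hv : quadForm δ v ≠ 0) : reflectionGL δ v ∈ SO δ :=
  mem_SO_iff.2 fun x => by rw [reflectionGL_mulVec, quadForm_reflection hv]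

variable (δ) in
/-- The group generated by the reflections. -/
def reflectionGroup : Subgroup (GL (Fin 4) F) :=
  Subgroup.closure {A | ∃ v, quadForm δ v ≠ 0 ∧ A = reflectionGL δ v}

lemma reflectionGL_mem {v : Fin 4 → F} (hv : quadForm δ v ≠ 0) :
    reflectionGL δ v ∈ reflectionGroup δ :=
  Subgroup.subset_closure ⟨v, hv, rfl⟩

/-- An isometry can be modified by a reflection to fix a further vector `u`, when its displacement
of `u` is zero or nonsingular. -/
lemma exists_isometry_fixing {A : GL (Fin 4) F} (hA : A ∈ SO δ) (u : Fin 4 → F)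
    (hu : A.val *ᵥ u ≠ u → quadForm δ (A.val *ᵥ u + u) ≠ 0) :
    ∃ A' ∈ SO δ, A'.val *ᵥ u = u ∧ (∀ z, A.val *ᵥ z = z → A'.val *ᵥ z = z) ∧
      (A' ∈ reflectionGroup δ → A ∈ reflectionGroup δ) := by
  by_cases h : A.val *ᵥ u = u
  · exact ⟨A, hA, h, fun _ => id, id⟩
  · have hv := hu h
    refine ⟨reflectionGL δ (A.val *ᵥ u + u) * A, mul_mem (reflectionGL_mem_SO hv) hA, ?_, ?_, ?_⟩
    · rw [Units.val_mul, ← Matrix.mulVec_mulVec, reflectionGL_mulVec,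
        reflection_add_left (hA.2 u) hv]
    · intro z hz
      rw [Units.val_mul, ← Matrix.mulVec_mulVec, reflectionGL_mulVec, hz]
      refine reflection_of_polarForm_eq_zero δ ?_
      have := polarForm_of_quadForm hA.2 z u
      rw [hz] at this
      rw [polarForm_add_right, this, CharTwo.add_self_eq_zero]
    · exact fun h' => (Subgroup.mul_mem_cancel_left _ (reflectionGL_mem hv)).1 h'

/-- The quadratic form has Witt index at most one when its restriction to the first two coordinates
is anisotropic. -/
lemma exists_smul_eq_of_singular (hδ : ∀ a b : F, a ^ 2 + δ * b ^ 2 + a * b = 0 → a = 0 ∧ b = 0)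
    {x y : Fin 4 → F} (hx : quadForm δ x = 0) (hy : quadForm δ y = 0) (hxy : polarForm x y = 0)
    (hx0 : x ≠ 0) : ∃ c : F, y = c • x := by
  have key : ∀ z : Fin 4 → F, quadForm δ z = 0 → z 3 = 0 → z = z 2 • ![0, 0, 1, 0] := by
    intro z hz h3
    obtain ⟨h0, h1⟩ := hδ (z 0) (z 1) (by rw [quadForm, h3] at hz; linear_combination hz)
    ext i
    fin_cases i <;> simp [h0, h1, h3]
  by_cases h3 : x 3 = 0
  · have hx' := key x hx h3
    have h2 : x 2 ≠ 0 := fun h => hx0 (by rw [hx', h, zero_smul])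
    rw [hx', polarForm_smul_left] at hxy
    have hy3 : y 3 = 0 := by simpa [polarForm, h2] using hxy
    refine ⟨y 2 / x 2, ?_⟩
    rw [key y hy hy3, hx']
    simp [h2]
  -- The vector y + cx is again singular and orthogonal to x, and its last coordinate vanishes, so
  -- `key` makes it a multiple of (0, 0, 1, 0). Pairing with x, whose last coordinate is nonzero,
  -- shows that it is zero.
  · set c := y 3 / x 3
    have hz : quadForm δ (y + c • x) = 0 := by
      rw [quadForm_add, hy, quadForm_smul, hx, polarForm_smul_right, polarForm_comm, hxy]
      ring
    have hz3 : (y + c • x) 3 = 0 := by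
      simp [c, h3, CharTwo.add_self_eq_zero]
    have hz' := key _ hz hz3
    have h : polarForm x (y + c • x) = 0 := by
      rw [polarForm_add_right, polarForm_smul_right, polarForm_self, hxy]; ring
    rw [hz', polarForm_smul_right] at h
    have h2 : (y + c • x) 2 = 0 := by simpa [polarForm, h3] using h
    rw [h2, zero_smul] at hz'
    exact ⟨c, CharTwo.add_eq_zero.1 hz'⟩

lemma polarForm_fixed {A : GL (Fin 4) F} (hA : A ∈ SO δ) {z : Fin 4 → F} (hz : A.val *ᵥ z = z)
    (u : Fin 4 → F) : polarForm z (A.val *ᵥ u + u) = 0 := by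
  have := polarForm_of_quadForm hA.2 z u
  rw [hz] at this
  rw [polarForm_add_right, this, CharTwo.add_self_eq_zero]

/-- A Cartan–Dieudonné theorem: the orthogonal group is generated by reflections. -/
lemma SO_le_reflectionGroup
    (hδ : ∀ a b : F, a ^ 2 + δ * b ^ 2 + a * b = 0 → a = 0 ∧ b = 0) :
    SO δ ≤ reflectionGroup δ := by
  -- The orthogonal complement of this hyperbolic pair is an anisotropic plane, so every nonzero
  -- displacement inside it defines a reflection.
  have planar : ∀ z : Fin 4 → F, polarForm ![0, 0, 1, 0] z = 0 → polarForm ![0, 0, 0, 1] z = 0 →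
      z ≠ 0 → quadForm δ z ≠ 0 := by
    intro z h1 h2 hz hq
    simp [polarForm] at h1 h2
    obtain ⟨h3, h4⟩ := hδ (z 0) (z 1) (by rw [quadForm, h1] at hq; linear_combination hq)
    exact hz (by ext i; fin_cases i <;> simp [h1, h2, h3, h4])
  -- the case where both vectors of a hyperbolic pair are fixed
  have fix23 : ∀ A ∈ SO δ, A.val *ᵥ ![0, 0, 1, 0] = ![0, 0, 1, 0] →
      A.val *ᵥ ![0, 0, 0, 1] = ![0, 0, 0, 1] → A ∈ reflectionGroup δ := by
    intro A hA h2 h3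
    obtain ⟨A₁, hA₁, h₁, hf₁, hr₁⟩ := exists_isometry_fixing hA ![1, 0, 0, 0] fun hne =>
      planar _ (polarForm_fixed hA h2 _) (polarForm_fixed hA h3 _)
        (fun h => hne (CharTwo.add_eq_zero.1 h))
    obtain ⟨A₂, hA₂, h₂, hf₂, hr₂⟩ := exists_isometry_fixing hA₁ ![0, 1, 0, 0] fun hne =>
      planar _ (polarForm_fixed hA₁ (hf₁ _ h2) _) (polarForm_fixed hA₁ (hf₁ _ h3) _)
        (fun h => hne (CharTwo.add_eq_zero.1 h))
    refine hr₁ (hr₂ ?_)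
    suffices A₂ = 1 from this ▸ one_mem _
    refine Units.ext (Matrix.ext_of_mulVec_single fun i => ?_)
    have e0 := hf₂ _ h₁
    have e2 := hf₂ _ (hf₁ _ h2)
    have e3 := hf₂ _ (hf₁ _ h3)
    have b0 : (![1, 0, 0, 0] : Fin 4 → F) = Pi.single 0 1 := by ext i; fin_cases i <;> rfl
    have b1 : (![0, 1, 0, 0] : Fin 4 → F) = Pi.single 1 1 := by ext i; fin_cases i <;> rfl
    have b2 : (![0, 0, 1, 0] : Fin 4 → F) = Pi.single 2 1 := by ext i; fin_cases i <;> rfl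
    have b3 : (![0, 0, 0, 1] : Fin 4 → F) = Pi.single 3 1 := by ext i; fin_cases i <;> rfl
    rw [b0] at e0
    rw [b1] at h₂
    rw [b2] at e2
    rw [b3] at e3
    rw [Units.val_one, Matrix.one_mulVec]
    fin_cases i
    exacts [e0, h₂, e2, e3]
  -- Let e, f be the hyperbolic pair and w = Af. As w and f are singular, Q(w + f) = B(w, f). If
  -- this vanishes, Witt index one gives w = cf, and pairing w + f with the fixed vector e forces c
  -- = 1, so f was already fixed.
  have fix2 : ∀ A ∈ SO δ, A.val *ᵥ ![0, 0, 1, 0] = ![0, 0, 1, 0] → A ∈ reflectionGroup δ := by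
    intro A hA h2
    obtain ⟨A₁, hA₁, h₁, hf₁, hr₁⟩ := exists_isometry_fixing hA ![0, 0, 0, 1] fun hne hq => by
      set w := A.val *ᵥ ![0, 0, 0, 1] with hw
      have hs : quadForm δ ![0, 0, 0, 1] = 0 := by simp [quadForm]
      have hsw : quadForm δ w = 0 := (hA.2 _).trans hs
      have hp : polarForm ![0, 0, 0, 1] w = 0 := by
        rw [quadForm_add, hs, hsw, polarForm_comm] at hq
        simpa using hq
      obtain ⟨c, hc⟩ := exists_smul_eq_of_singular hδ hs hsw hp
        (fun h => by simpa using congrFun h 3)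
      have h := polarForm_fixed hA h2 ![0, 0, 0, 1]
      rw [← hw, hc] at h
      simp [polarForm] at h
      rw [CharTwo.add_eq_zero] at h
      exact hne (by rw [hc, h, one_smul])
    exact hr₁ (fix23 A₁ hA₁ (hf₁ _ h2) h₁)
  have fix2' : ∀ A ∈ SO δ, polarForm (A.val *ᵥ ![0, 0, 1, 0]) ![0, 0, 1, 0] ≠ 0 →
      A ∈ reflectionGroup δ := by
    intro A hA hne
    have hs : quadForm δ ![0, 0, 1, 0] = 0 := by simp [quadForm]
    obtain ⟨A₁, hA₁, h₁, -, hr₁⟩ := exists_isometry_fixing hA ![0, 0, 1, 0] fun _ => by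
      rw [quadForm_add, hA.2, hs]
      simpa using hne
    exact hr₁ (fix2 A₁ hA₁ h₁)
  intro A hA
  by_cases h : polarForm (A.val *ᵥ ![0, 0, 1, 0]) ![0, 0, 1, 0] = 0
  · have hs : quadForm δ ![0, 0, 1, 0] = 0 := by simp [quadForm]
    have h20 : (![0, 0, 1, 0] : Fin 4 → F) ≠ 0 := fun h => by simpa using congrFun h 2
    obtain ⟨c, hc⟩ := exists_smul_eq_of_singular hδ hs ((hA.2 _).trans hs)
      ((polarForm_comm _ _).trans h) h20
    have hc0 : c ≠ 0 := by
      rintro rfl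
      rw [zero_smul] at hc
      exact h20 (mulVec_injective A (by simp [hc]))
    -- Reflection in e + f interchanges e and f. It turns the image ce into cf, which is not
    -- orthogonal to e, so that `fix2'` applies.
    have hv : quadForm δ ![0, 0, 1, 1] ≠ 0 := by simp [quadForm]
    refine (Subgroup.mul_mem_cancel_left _ (reflectionGL_mem hv)).1
      (fix2' _ (mul_mem (reflectionGL_mem_SO hv) hA) ?_)
    rw [Units.val_mul, ← Matrix.mulVec_mulVec, hc, reflectionGL_mulVec, reflection_eq]
    simp [polarForm, quadForm, hc0]
  · exact fix2' A hA h

lemma reflectionGL_mul_mem_Omega {v w : Fin 4 → F} (hv : quadForm δ v ≠ 0)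
    (hw : quadForm δ w ≠ 0) : reflectionGL δ v * reflectionGL δ w ∈ Omega δ :=
  Subgroup.subset_closure ⟨v, w, hv, hw, fun x => by
    rw [Units.val_mul, ← Matrix.mulVec_mulVec, reflectionGL_mulVec, reflectionGL_mulVec]⟩

lemma reflectionGL_inv (v : Fin 4 → F) : (reflectionGL δ v)⁻¹ = reflectionGL δ v :=
  inv_eq_of_mul_eq_one_right (reflectionGL_mul_self δ v)

/-- Elements of the group generated by reflections are products of an even number of reflections,
up to one fixed reflection. -/
lemma mem_Omega_or_of_mem_reflectionGroup {v : Fin 4 → F} (hv : quadForm δ v ≠ 0)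
    {A : GL (Fin 4) F} (hA : A ∈ reflectionGroup δ) :
    A ∈ Omega δ ∨ reflectionGL δ v * A ∈ Omega δ := by
  have step : ∀ w, quadForm δ w ≠ 0 → ∀ B : GL (Fin 4) F,
      B ∈ Omega δ ∨ reflectionGL δ v * B ∈ Omega δ →
      reflectionGL δ w * B ∈ Omega δ ∨ reflectionGL δ v * (reflectionGL δ w * B) ∈ Omega δ := by
    rintro w hw B (hB | hB)
    · right
      rw [← mul_assoc]
      exact mul_mem (reflectionGL_mul_mem_Omega hv hw) hB
    · left
      have := mul_mem (reflectionGL_mul_mem_Omega hw hv) hB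
      rwa [mul_assoc, ← mul_assoc (reflectionGL δ v), reflectionGL_mul_self, one_mul] at this
  induction hA using Subgroup.closure_induction_left with
  | one => exact Or.inl (one_mem _)
  | mul_left x hx y hy ih =>
    obtain ⟨w, hw, rfl⟩ := hx
    exact step w hw y ih
  | inv_mul_cancel x hx y hy ih =>
    obtain ⟨w, hw, rfl⟩ := hx
    rw [reflectionGL_inv]
    exact step w hw y ih

lemma exists_reflectionGL_mul_of_generator {A : GL (Fin 4) F}
    (hA : A ∈ {A : GL (Fin 4) F | ∃ v w : Fin 4 → F, quadForm δ v ≠ 0 ∧ quadForm δ w ≠ 0 ∧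
      ∀ x, A.val *ᵥ x = reflection δ v (reflection δ w x)}) :
    ∃ v w : Fin 4 → F, quadForm δ v ≠ 0 ∧ quadForm δ w ≠ 0 ∧
      A = reflectionGL δ v * reflectionGL δ w := by
  obtain ⟨v, w, hv, hw, h⟩ := hA
  refine ⟨v, w, hv, hw, Units.ext (Matrix.ext_of_mulVec_single fun i => ?_)⟩
  rw [h, Units.val_mul, ← Matrix.mulVec_mulVec, reflectionGL_mulVec, reflectionGL_mulVec]

lemma Omega_le_SO : Omega δ ≤ SO δ := by
  refine (Subgroup.closure_le _).2 fun A hA => ?_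
  obtain ⟨v, w, hv, hw, rfl⟩ := exists_reflectionGL_mul_of_generator hA
  exact mul_mem (reflectionGL_mem_SO hv) (reflectionGL_mem_SO hw)

end Isometries

/-! ### Parity of isometries over GF(q), read off from the rulings over GF(q²) -/

section Parity

variable {F K : Type*} [Field F] [Field K] [Algebra F K] [CharP F 2] [CharP K 2] {δ : F} {υ : K}

omit [CharP F 2] [CharP K 2] in
lemma quadForm_algebraMap (x : Fin 4 → F) :
    quadForm (algebraMap F K δ) (algebraMap F K ∘ x) = algebraMap F K (quadForm δ x) := by
  simp [quadForm]

omit [CharP F 2] [CharP K 2] in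
lemma polarForm_algebraMap (x y : Fin 4 → F) :
    polarForm (algebraMap F K ∘ x) (algebraMap F K ∘ y) = algebraMap F K (polarForm x y) := by
  simp [polarForm]

omit [CharP F 2] [CharP K 2] in
lemma map_mulVec (A : GL (Fin 4) F) (x : Fin 4 → F) :
    (Matrix.GeneralLinearGroup.map (algebraMap F K) A).val *ᵥ (algebraMap F K ∘ x) =
      algebraMap F K ∘ (A.val *ᵥ x) :=
  (funext (RingHom.map_mulVec (algebraMap F K) A.val x)).symm

lemma map_reflectionGL (v : Fin 4 → F) :
    Matrix.GeneralLinearGroup.map (algebraMap F K) (reflectionGL δ v) =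
      reflectionGL (algebraMap F K δ) (algebraMap F K ∘ v) := by
  refine Units.ext (Matrix.ext_of_mulVec_single fun i => ?_)
  have h : (Pi.single i 1 : Fin 4 → K) = algebraMap F K ∘ (Pi.single i 1 : Fin 4 → F) := by
    ext j; by_cases h : i = j
    · subst h; simp
    · simp [Pi.single_apply, apply_ite]
  rw [h, map_mulVec, reflectionGL_mulVec, reflectionGL_mulVec, reflection_eq, reflection_eq,
    quadForm_algebraMap, polarForm_algebraMap]
  ext j
  simp

lemma subfieldAction_reflectionGL (v : Fin 4 → F) :
    subfieldAction F K (reflectionGL δ v) =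
      act (reflectionGL (algebraMap F K δ) (algebraMap F K ∘ v)) := by
  rw [← map_reflectionGL]; rfl

variable (hδ : algebraMap F K δ = υ * (υ + 1))
include hδ

omit [CharP F 2] [CharP K 2] in
lemma quadForm_algebraMap_ne_zero {v : Fin 4 → F} (hv : quadForm δ v ≠ 0) :
    quadForm (υ * (υ + 1)) (algebraMap F K ∘ v) ≠ 0 := by
  rw [← hδ, quadForm_algebraMap]
  exact (map_ne_zero _).2 hv

lemma subfieldAction_reflectionGL_smul_ruling₁ {v : Fin 4 → F} (hv : quadForm δ v ≠ 0) :
    subfieldAction F K (reflectionGL δ v) • ruling₁ υ = ruling₂ υ := by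
  rw [subfieldAction_reflectionGL, hδ]
  exact reflectionGL_smul_ruling₁ (quadForm_algebraMap_ne_zero hδ hv)

lemma subfieldAction_reflectionGL_smul_ruling₂ {v : Fin 4 → F} (hv : quadForm δ v ≠ 0) :
    subfieldAction F K (reflectionGL δ v) • ruling₂ υ = ruling₁ υ := by
  rw [subfieldAction_reflectionGL, hδ]
  exact reflectionGL_smul_ruling₂ (quadForm_algebraMap_ne_zero hδ hv)

/-- Each generator is a product of two reflections, each of which interchanges the rulings. -/
lemma POmega_le_stabilizer :
    POmega K δ ≤ MulAction.stabilizer (Equiv.Perm (Pt K)) (ruling₁ υ) ⊓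
      MulAction.stabilizer (Equiv.Perm (Pt K)) (ruling₂ υ) := by
  refine Subgroup.map_le_iff_le_comap.2 ((Subgroup.closure_le _).2 fun A hA => ?_)
  obtain ⟨v, w, hv, hw, rfl⟩ := exists_reflectionGL_mul_of_generator hA
  refine ⟨?_, ?_⟩ <;> simp only [Subgroup.coe_toSubmonoid, SetLike.mem_coe,
    MulAction.mem_stabilizer_iff, map_mul, mul_smul]
  · rw [subfieldAction_reflectionGL_smul_ruling₁ hδ hw,
      subfieldAction_reflectionGL_smul_ruling₂ hδ hv]
  · rw [subfieldAction_reflectionGL_smul_ruling₂ hδ hw,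
      subfieldAction_reflectionGL_smul_ruling₁ hδ hv]

lemma reflectionGL_notMem_POmega {v : Fin 4 → F} (hv : quadForm δ v ≠ 0) :
    subfieldAction F K (reflectionGL δ v) ∉ POmega K δ := by
  intro h
  have h1 := (POmega_le_stabilizer hδ h).1
  exact ruling₁_ne_ruling₂ υ (h1.symm.trans (subfieldAction_reflectionGL_smul_ruling₁ hδ hv))

omit hδ [CharP K 2] in
lemma mem_POmega_or (haniso : ∀ a b : F, a ^ 2 + δ * b ^ 2 + a * b = 0 → a = 0 ∧ b = 0)
    {v : Fin 4 → F} (hv : quadForm δ v ≠ 0) {g : Equiv.Perm (Pt K)} (hg : g ∈ PSO K δ) :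
    g ∈ POmega K δ ∨ subfieldAction F K (reflectionGL δ v) * g ∈ POmega K δ := by
  obtain ⟨A, hA, rfl⟩ := hg
  refine (mem_Omega_or_of_mem_reflectionGroup hv (SO_le_reflectionGroup haniso hA)).imp
    (fun h => ⟨A, h, rfl⟩) (fun h => ⟨_, h, map_mul _ _ _⟩)

/-- An element that is not even becomes even after multiplication by one reflection, hence it moves
the first ruling to the second. One ruling thus suffices to detect parity. -/
lemma mem_POmega_iff (haniso : ∀ a b : F, a ^ 2 + δ * b ^ 2 + a * b = 0 → a = 0 ∧ b = 0)
    {g : Equiv.Perm (Pt K)} (hg : g ∈ PSO K δ) : g ∈ POmega K δ ↔ g • ruling₁ υ = ruling₁ υ := by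
  refine ⟨fun h => (POmega_le_stabilizer hδ h).1, fun h => ?_⟩
  have hv : quadForm δ ![1, 0, 0, 0] ≠ 0 := by simp [quadForm]
  refine (mem_POmega_or haniso hv hg).resolve_right fun h' => ?_
  have h1 := (POmega_le_stabilizer hδ h').1
  rw [Subgroup.coe_toSubmonoid, SetLike.mem_coe, MulAction.mem_stabilizer_iff, mul_smul, h,
    subfieldAction_reflectionGL_smul_ruling₁ hδ hv] at h1
  exact ruling₁_ne_ruling₂ υ h1.symm

end Parity
end RelHemi

/-! ### Arithmetic of the quadratic extension -/

namespace RelHemi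

/-- The arithmetic of the extension `GF(q²) = GF(q)(υ)` that is used below. -/
structure ArtinSchreierPair {F K : Type*} [Field F] [Field K] [Algebra F K] (q : ℕ) (υ : K)
    (δ : F) : Prop where
  ne_zero : q ≠ 0
  add_pow : ∀ x y : K, (x + y) ^ q = x ^ q + y ^ q
  algebraMap_pow : ∀ a : F, algebraMap F K a ^ q = algebraMap F K a
  upsilon_pow : υ ^ q = υ + 1
  algebraMap_delta : algebraMap F K δ = υ * (υ + 1)
  decomp : ∀ t : K, ∃ a b : F, t = algebraMap F K a + υ * algebraMap F K b
  sq_F : ∀ a : F, ∃ b, a = b ^ 2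
  sq_K : ∀ a : K, ∃ b, a = b ^ 2

lemma charP_two_of_natCard {F : Type*} [Field F] {k : ℕ} (hF : Nat.card F = 2 ^ k) :
    CharP F 2 := by
  have : Finite F := Nat.finite_of_card_ne_zero (by rw [hF]; positivity)
  have := Fintype.ofFinite F
  obtain ⟨p, hp⟩ := CharP.exists F
  obtain ⟨n, hpr, hn⟩ := FiniteField.card F p
  rw [← Nat.card_eq_fintype_card, hF] at hn
  have h2 : p ∣ 2 ^ k := hn ▸ dvd_pow_self p n.ne_zero
  have := (Nat.prime_dvd_prime_iff_eq hpr Nat.prime_two).1 (hpr.dvd_of_dvd_pow h2)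
  rwa [this] at hp

lemma exists_eq_sq {F : Type*} [Field F] [Finite F] [CharP F 2] (a : F) : ∃ b, a = b ^ 2 := by
  obtain ⟨b, hb⟩ := FiniteField.isSquare_of_char_two (ringChar.eq F 2) a
  exact ⟨b, by rw [hb, sq]⟩

/-- The element υ is moved by the q-th power map, which fixes the subfield; so 1 and υ are
independent and form a basis. Square roots exist because finite fields of characteristic two are
perfect. -/
lemma artinSchreierPair {F K : Type*} [Field F] [Field K] [Algebra F K] [CharP F 2] [CharP K 2]
    {k q : ℕ} (hq : q = 2 ^ k) (hF : Nat.card F = q) (hK : Module.finrank F K = 2)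
    {υ : K} (hυ : υ ^ q + υ = 1) {δ : F} (hδ : algebraMap F K δ = υ ^ (q + 1)) :
    ArtinSchreierPair q υ δ := by
  have hq0 : q ≠ 0 := by rw [hq]; positivity
  have : Finite F := Nat.finite_of_card_ne_zero (by rwa [hF])
  have : Module.Finite F K := Module.finite_of_finrank_pos (by omega)
  have : Finite K := Module.finite_of_finite F
  have hF' : ∀ a : F, algebraMap F K a ^ q = algebraMap F K a := by
    intro a
    have := Fintype.ofFinite F
    rw [← map_pow, ← hF, Nat.card_eq_fintype_card, FiniteField.pow_card]
  have hup : υ ^ q = υ + 1 := by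
    linear_combination hυ - υ * (CharTwo.two_eq_zero : (2 : K) = 0)
  have hli : LinearIndependent F ![(1 : K), υ] := by
    rw [LinearIndependent.pair_iff' one_ne_zero]
    intro a ha
    have h1 := hF' a
    rw [Algebra.algebraMap_eq_smul_one, ha, hup] at h1
    simp at h1
  refine ⟨hq0, fun x y => ?_, hF', hup, by rw [hδ, pow_succ, hup, mul_comm], fun t => ?_,
    exists_eq_sq, exists_eq_sq⟩
  · rw [hq]; exact add_pow_char_pow x y 2 k
  · have ht : t ∈ Submodule.span F (Set.range ![(1 : K), υ]) := by
      rw [hli.span_eq_top_of_card_eq_finrank (by simp [hK])]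
      trivial
    simp only [Matrix.range_cons, Matrix.range_empty, Set.union_empty, Set.singleton_union] at ht
    obtain ⟨a, b, h⟩ := Submodule.mem_span_pair.1 ht
    exact ⟨a, b, by rw [← h, Algebra.smul_def, Algebra.smul_def]; ring⟩

/-! ### Conjugation, and the stabiliser of the quadric in PGU(4, q) -/

/-- The coordinatewise conjugation `x ↦ x^q`. -/
def conj {K : Type*} [Field K] (q : ℕ) (x : Fin 4 → K) : Fin 4 → K := fun i => x i ^ q

lemma hermForm_eq {K : Type*} [Field K] (q : ℕ) (x y : Fin 4 → K) :
    hermForm q x y = polarForm x (conj q y) := rfl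

lemma conj_smul {K : Type*} [Field K] (q : ℕ) (c : K) (x : Fin 4 → K) :
    conj q (c • x) = c ^ q • conj q x := by
  ext i; simp [conj, mul_pow]

/-- Proportional matrices induce the same permutation of points. -/
lemma act_eq_of_smul {K : Type*} [Field K] {A B : GL (Fin 4) K} {s : K}
    (h : A.val = s • B.val) : act A = act B := by
  refine Equiv.ext fun p => ?_
  induction p using Projectivization.ind with | _ v hv =>
  change A • Projectivization.mk K v hv = B • Projectivization.mk K v hv
  rw [Projectivization.smul_mk, Projectivization.smul_mk, Projectivization.mk_eq_mk_iff']
  refine ⟨s, ?_⟩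
  change s • (B.val *ᵥ v) = A.val *ᵥ v
  rw [h, Matrix.smul_mulVec]

lemma polarForm_nondegenerate {K : Type*} [Field K] {x y : Fin 4 → K}
    (h : ∀ z, polarForm z x = polarForm z y) : x = y := by
  ext i
  have h0 := h ![1, 0, 0, 0]
  have h1 := h ![0, 1, 0, 0]
  have h2 := h ![0, 0, 1, 0]
  have h3 := h ![0, 0, 0, 1]
  simp [polarForm] at h0 h1 h2 h3
  fin_cases i <;> simpa

/-- A quadratic form obtained by a linear substitution and vanishing on the zeros of a hyperbolic
form is proportional to it. -/
lemma exists_quadForm_mulVec_eq {K : Type*} [Field K] [CharP K 2] {υ : K}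
    {A : Matrix (Fin 4) (Fin 4) K}
    (hA : ∀ x, quadForm (υ * (υ + 1)) x = 0 → quadForm (υ * (υ + 1)) (A *ᵥ x) = 0) :
    ∃ c, ∀ x, quadForm (υ * (υ + 1)) (A *ᵥ x) = c * quadForm (υ * (υ + 1)) x := by
  have h0 : (2 : K) = 0 := CharTwo.two_eq_zero
  set Q := quadForm (υ * (υ + 1)) with hQ
  -- The vectors p, r and e, f form two mutually orthogonal hyperbolic pairs; in the coordinates a,
  -- b, c, d they define, the form is ab + cd.
  set p : Fin 4 → K := ![υ + 1, 1, 0, 0] with hp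
  set r : Fin 4 → K := ![υ, 1, 0, 0] with hr
  set e : Fin 4 → K := ![0, 0, 1, 0] with he
  set f : Fin 4 → K := ![0, 0, 0, 1] with hf
  have zp : Q p = 0 := by simp [hQ, hp, quadForm]; linear_combination (υ + 1) ^ 2 * h0
  have zr : Q r = 0 := by simp [hQ, hr, quadForm]; linear_combination (υ ^ 2 + υ) * h0
  have ze : Q e = 0 := by simp [hQ, he, quadForm]
  have zf : Q f = 0 := by simp [hQ, hf, quadForm]
  have orth : ∀ x y, Q x = 0 → Q y = 0 → polarForm x y = 0 → polarForm (A *ᵥ x) (A *ᵥ y) = 0 := by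
    intro x y hx hy hxy
    have h := hA (x + y) (by rw [hQ, quadForm_add, ← hQ, hx, hy, hxy]; ring)
    rw [Matrix.mulVec_add, hQ, quadForm_add, ← hQ, hA x hx, hA y hy] at h
    simpa using h
  have ope := orth p e zp ze (by simp [polarForm, hp, he])
  have opf := orth p f zp zf (by simp [polarForm, hp, hf])
  have ore := orth r e zr ze (by simp [polarForm, hr, he])
  have orf := orth r f zr zf (by simp [polarForm, hr, hf])
  have expand : ∀ a b c d : K, Q (A *ᵥ (a • p + b • r + c • e + d • f)) =
      a * b * polarForm (A *ᵥ p) (A *ᵥ r) + c * d * polarForm (A *ᵥ e) (A *ᵥ f) := by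
    intro a b c d
    simp only [Matrix.mulVec_add, Matrix.mulVec_smul, hQ, quadForm_add, quadForm_smul,
      polarForm_add_left, polarForm_smul_left, polarForm_smul_right, ope, opf, ore, orf]
    simp only [← hQ, hA p zp, hA r zr, hA e ze, hA f zf]
    ring
  -- The sum of the four basis vectors is singular since 1 + 1 = 0. Its image being singular makes
  -- the coefficients of ab and cd equal.
  have hsum : Q (A *ᵥ ((1 : K) • p + (1 : K) • r + (1 : K) • e + (1 : K) • f)) = 0 := by
    refine hA _ ?_
    simp [hQ, hp, hr, he, hf, quadForm]
    linear_combination (4 * υ ^ 2 + 6 * υ + 2) * h0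
  rw [expand] at hsum
  refine ⟨polarForm (A *ᵥ p) (A *ᵥ r), fun x => ?_⟩
  have hx : x = (x 0 + υ * x 1) • p + (x 0 + (υ + 1) * x 1) • r + x 2 • e + x 3 • f := by
    ext i
    fin_cases i
    · simp [hp, hr, he, hf]
      linear_combination (-(υ * x 0) - (υ ^ 2 + υ) * x 1) * h0
    · simp [hp, hr, he, hf]
      linear_combination (- x 0 - υ * x 1) * h0
    · simp [hp, hr, he, hf]
    · simp [hp, hr, he, hf]
  conv_lhs => rw [hx]
  rw [expand]
  simp only [hQ, quadForm]
  linear_combination x 2 * x 3 * hsum +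
    polarForm (A *ᵥ p) (A *ᵥ r) * (υ * x 0 * x 1 - x 2 * x 3) * h0

namespace ArtinSchreierPair

variable {F K : Type*} [Field F] [Field K] [Algebra F K]
  {q : ℕ} {υ : K} {δ : F} (S : ArtinSchreierPair q υ δ)
include S

lemma conj_add (x y : Fin 4 → K) : conj q (x + y) = conj q x + conj q y :=
  funext fun i => S.add_pow (x i) (y i)

lemma conj_algebraMap (x : Fin 4 → F) : conj q (algebraMap F K ∘ x) = algebraMap F K ∘ x :=
  funext fun i => S.algebraMap_pow (x i)

lemma zero_pow : (0 : K) ^ q = 0 := _root_.zero_pow S.ne_zero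

lemma sum_pow {ι : Type*} (s : Finset ι) (f : ι → K) : (∑ i ∈ s, f i) ^ q = ∑ i ∈ s, f i ^ q := by
  classical
  induction s using Finset.induction_on with
  | empty => simpa using S.zero_pow
  | insert a s ha ih => rw [Finset.sum_insert ha, Finset.sum_insert ha, S.add_pow, ih]

lemma conj_mulVec (A : Matrix (Fin 4) (Fin 4) K) (x : Fin 4 → K) :
    conj q (A *ᵥ x) = A.map (· ^ q) *ᵥ conj q x := by
  ext i
  simp [conj, Matrix.mulVec, dotProduct, S.sum_pow, mul_pow]

lemma conj_map_mulVec (A : GL (Fin 4) F) (x : Fin 4 → K) :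
    conj q ((Matrix.GeneralLinearGroup.map (algebraMap F K) A).val *ᵥ x) =
      (Matrix.GeneralLinearGroup.map (algebraMap F K) A).val *ᵥ conj q x := by
  rw [S.conj_mulVec]
  congr 1
  ext i j
  simp [S.algebraMap_pow]

lemma polarForm_conj (x y : Fin 4 → K) :
    polarForm (conj q x) (conj q y) = polarForm x y ^ q := by
  simp [polarForm, conj, S.add_pow, mul_pow]

lemma quadForm_conj (x : Fin 4 → K) :
    quadForm (υ * (υ + 1)) (conj q x) = quadForm (υ * (υ + 1)) x ^ q := by
  have h := S.algebraMap_pow δ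
  rw [S.algebraMap_delta] at h
  simp only [quadForm, conj, S.add_pow, mul_pow (υ * (υ + 1)), mul_pow (x _), h, ← pow_mul,
    mul_comm q 2]

variable [CharP K 2]

omit [CharP K 2] in
lemma pow_algebraMap_add (a b : F) : (algebraMap F K a + υ * algebraMap F K b) ^ q =
    algebraMap F K a + (υ + 1) * algebraMap F K b := by
  rw [S.add_pow, mul_pow, S.algebraMap_pow, S.algebraMap_pow, S.upsilon_pow]

lemma pow_pow (t : K) : (t ^ q) ^ q = t := by
  obtain ⟨a, b, rfl⟩ := S.decomp t
  have h1 : (1 : K) ^ q = 1 := one_pow q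
  rw [S.pow_algebraMap_add, S.add_pow, mul_pow, S.algebraMap_pow, S.algebraMap_pow, S.add_pow,
    S.upsilon_pow, h1]
  linear_combination algebraMap F K b * (CharTwo.two_eq_zero : (2 : K) = 0)

lemma conj_conj (x : Fin 4 → K) : conj q (conj q x) = x := funext fun i => S.pow_pow (x i)

omit [CharP K 2] in
lemma exists_algebraMap {t : K} (h : t ^ q = t) : ∃ a : F, t = algebraMap F K a := by
  obtain ⟨a, b, rfl⟩ := S.decomp t
  rw [S.pow_algebraMap_add] at h
  have hb : algebraMap F K b = 0 := by linear_combination h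
  exact ⟨a, by rw [hb]; ring⟩

omit [CharP K 2] in
lemma eq_zero_of_add_eq_zero {a b : F} (h : algebraMap F K a + υ * algebraMap F K b = 0) :
    a = 0 ∧ b = 0 := by
  have h' := S.pow_algebraMap_add a b
  rw [h, S.zero_pow] at h'
  have hb : algebraMap F K b = 0 := by linear_combination -h' - h
  have ha : algebraMap F K a = 0 := by linear_combination h - υ * hb
  exact ⟨(map_eq_zero _).1 ha, (map_eq_zero _).1 hb⟩

/-- The binary form is the norm (a + υb)^(q+1) from the quadratic extension. -/
lemma anisotropic (a b : F) (h : a ^ 2 + δ * b ^ 2 + a * b = 0) : a = 0 ∧ b = 0 := by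
  have h1 : (algebraMap F K a + υ * algebraMap F K b) ^ (q + 1) = 0 := by
    rw [pow_succ, S.pow_algebraMap_add]
    have h2 := congrArg (algebraMap F K) h
    simp only [map_add, map_mul, map_pow, map_zero, S.algebraMap_delta] at h2
    linear_combination h2 + υ * algebraMap F K a * algebraMap F K b *
      (CharTwo.two_eq_zero : (2 : K) = 0)
  exact S.eq_zero_of_add_eq_zero (pow_eq_zero_iff (by omega) |>.1 h1)

omit [CharP K 2] in
lemma exists_vec_decomp (x : Fin 4 → K) :
    ∃ a b : Fin 4 → F, x = algebraMap F K ∘ a + υ • (algebraMap F K ∘ b) := by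
  choose a b h using fun i => S.decomp (x i)
  exact ⟨a, b, funext fun i => h i⟩

variable [CharP F 2]

omit S [CharP F 2] in
lemma quadForm_vec (hδ : algebraMap F K δ = υ * (υ + 1)) (a b : Fin 4 → F) :
    quadForm (υ * (υ + 1)) (algebraMap F K ∘ a + υ • (algebraMap F K ∘ b)) =
      algebraMap F K (quadForm δ a) + υ ^ 2 * algebraMap F K (quadForm δ b) +
        υ * algebraMap F K (polarForm a b) := by
  rw [quadForm_add, quadForm_smul, polarForm_smul_right, ← hδ, quadForm_algebraMap,
    quadForm_algebraMap, polarForm_algebraMap]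

/-- Isometries over the subfield are isometries over the big field. -/
lemma quadForm_map_mulVec {A : GL (Fin 4) F} (hA : A ∈ SO δ) (x : Fin 4 → K) :
    quadForm (υ * (υ + 1)) ((Matrix.GeneralLinearGroup.map (algebraMap F K) A).val *ᵥ x) =
      quadForm (υ * (υ + 1)) x := by
  obtain ⟨a, b, rfl⟩ := S.exists_vec_decomp x
  rw [Matrix.mulVec_add, Matrix.mulVec_smul, map_mulVec, map_mulVec,
    quadForm_vec S.algebraMap_delta, quadForm_vec S.algebraMap_delta, hA.2, hA.2,
    polarForm_of_quadForm hA.2]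

lemma map_mem_GU {A : GL (Fin 4) F} (hA : A ∈ SO δ) :
    Matrix.GeneralLinearGroup.map (algebraMap F K) A ∈ GU K q := by
  intro x y
  rw [hermForm_eq, hermForm_eq, S.conj_map_mulVec,
    polarForm_of_quadForm (S.quadForm_map_mulVec hA)]

omit [CharP K 2] in
/-- A matrix over the big field that preserves the quadratic form and commutes with conjugation
comes from an isometry over the subfield. -/
lemma exists_mem_SO_of_pow_eq {A : Matrix (Fin 4) (Fin 4) K} (h : ∀ i j, A i j ^ q = A i j)
    (hA : ∀ x, quadForm (υ * (υ + 1)) (A *ᵥ x) = quadForm (υ * (υ + 1)) x) :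
    ∃ B ∈ SO δ, (Matrix.GeneralLinearGroup.map (algebraMap F K) B).val = A := by
  choose B hB using fun i j => S.exists_algebraMap (h i j)
  have hB' : A = (Matrix.of B).map (algebraMap F K) := by ext i j; exact hB i j
  obtain ⟨C, hC, hCB⟩ := exists_mem_SO (δ := δ) (A := Matrix.of B) fun x => by
    apply (algebraMap F K).injective
    rw [← quadForm_algebraMap, ← quadForm_algebraMap, S.algebraMap_delta,
      ← hA (algebraMap F K ∘ x), hB']
    exact congrArg _ (funext (RingHom.map_mulVec (algebraMap F K) (Matrix.of B) x))
  refine ⟨C, hC, ?_⟩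
  rw [hB', ← hCB]
  rfl

/-- `PSO⁻(4, q)` is the stabiliser of the hyperbolic quadric in `PGU(4, q)`. -/
lemma PSO_eq : PSO K δ = PGU K q ⊓
    MulAction.stabilizer (Equiv.Perm (Pt K)) (quadricPoints (υ * (υ + 1))) := by
  apply le_antisymm
  · rintro _ ⟨A, hA, rfl⟩
    refine ⟨⟨_, S.map_mem_GU hA, rfl⟩, ?_⟩
    refine smul_setOf_forall _ fun v => ?_
    rw [S.quadForm_map_mulVec hA]
  · rintro _ ⟨⟨A, hA, rfl⟩, hst⟩
    have hst' : act A • quadricPoints (υ * (υ + 1)) = quadricPoints (υ * (υ + 1)) := hst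
    obtain ⟨c, hc⟩ := exists_quadForm_mulVec_eq (υ := υ) (A := A.val) fun x hx => by
      by_cases hx0 : x = 0
      · rw [hx0, Matrix.mulVec_zero, quadForm_zero]
      · have h1 : Projectivization.mk K x hx0 ∈ quadricPoints (υ * (υ + 1)) := by
          intro v hv
          rw [Projectivization.submodule_mk, Submodule.mem_span_singleton] at hv
          obtain ⟨s, rfl⟩ := hv
          rw [quadForm_smul, hx, mul_zero]
        have h2 : act A • Projectivization.mk K x hx0 ∈ quadricPoints (υ * (υ + 1)) :=
          hst' ▸ Set.smul_mem_smul_set h1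
        refine h2 _ ?_
        rw [submodule_act, Projectivization.submodule_mk]
        exact Submodule.mem_map_of_mem (Submodule.mem_span_singleton_self x)
    have hp : ∀ x y, polarForm (A.val *ᵥ x) (A.val *ᵥ y) = c * polarForm x y := by
      intro x y
      have h := hc (x + y)
      rw [Matrix.mulVec_add, quadForm_add, quadForm_add, hc, hc] at h
      linear_combination h
    have hc0 : c ≠ 0 := by
      rintro rfl
      have h := hc (A⁻¹.val *ᵥ ![1, 0, 0, 0])
      rw [mulVecLin_inv_apply] at h
      simp [quadForm] at h
    -- Pair both sides with an arbitrary z = A(A⁻¹z): the left side is evaluated by Hermitian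
    -- invariance, the right side by the similarity of B with factor c.
    have hconj : ∀ y, c • conj q (A.val *ᵥ y) = A.val *ᵥ conj q y := by
      intro y
      refine polarForm_nondegenerate fun z => ?_
      have h := hA (A⁻¹.val *ᵥ z) y
      rw [hermForm_eq, hermForm_eq, mulVecLin_inv_apply] at h
      have h2 := hp (A⁻¹.val *ᵥ z) (conj q y)
      rw [mulVecLin_inv_apply] at h2
      rw [polarForm_smul_right, h, h2]
    have hentry : ∀ i j, c * A.val i j ^ q = A.val i j := by
      intro i j
      have h := congrFun (hconj (Pi.single j 1)) i
      have hs : conj q (Pi.single j 1 : Fin 4 → K) = Pi.single j 1 := by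
        ext m
        by_cases hm : m = j
        · subst hm; simp [conj]
        · simp [conj, hm, S.zero_pow]
      rw [hs] at h
      simpa [conj] using h
    obtain ⟨i, j, hij⟩ : ∃ i j, A.val i j ≠ 0 := by
      by_contra! h0
      have : A.val = 0 := by ext i j; exact h0 i j
      have h1 := A.val_inv
      rw [this, zero_mul] at h1
      exact zero_ne_one h1
    have ht : c * A.val i j ^ q = A.val i j := hentry i j
    set t := A.val i j
    -- Every entry a of A satisfies c a^q = a. Dividing by one nonzero entry t cancels the factor c,
    -- so the quotient matrix is fixed by the q-th power map.
    have htq : t⁻¹ ^ q = c * t⁻¹ := by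
      rw [inv_pow, ← ht]
      field_simp
      rw [ht]
    have hBpow : ∀ r m, (t⁻¹ • A.val) r m ^ q = (t⁻¹ • A.val) r m := by
      intro r m
      simp only [Matrix.smul_apply, smul_eq_mul, mul_pow, htq]
      linear_combination t⁻¹ * hentry r m
    have hform : ∀ x, quadForm (υ * (υ + 1)) ((t⁻¹ • A.val) *ᵥ x) =
        t⁻¹ ^ 2 * c * quadForm (υ * (υ + 1)) x := by
      intro x
      rw [Matrix.smul_mulVec, quadForm_smul, hc, mul_assoc]
    -- The multiplier is the value of Q at the image of a vector of norm 1, and this image is fixed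
    -- by conjugation. It therefore lies in the subfield, where a square root of it rescales the
    -- similarity to an isometry.
    have hfix : (t⁻¹ ^ 2 * c) ^ q = t⁻¹ ^ 2 * c := by
      have h1 := S.quadForm_conj ((t⁻¹ • A.val) *ᵥ ![1, 0, 0, 0])
      have h2 : conj q ((t⁻¹ • A.val) *ᵥ ![1, 0, 0, 0]) = (t⁻¹ • A.val) *ᵥ ![1, 0, 0, 0] := by
        rw [S.conj_mulVec]
        congr 1
        · ext r m; exact hBpow r m
        · ext m; fin_cases m <;> simp [conj, S.zero_pow]
      have h3 : quadForm (υ * (υ + 1)) ![1, 0, 0, 0] = 1 := by simp [quadForm]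
      rw [h2, hform, h3, mul_one] at h1
      exact h1.symm
    obtain ⟨e, he⟩ := S.exists_algebraMap hfix
    obtain ⟨f, rfl⟩ := S.sq_F e
    have hf0 : algebraMap F K f ≠ 0 := by
      intro h
      rw [map_pow, h] at he
      simp at he
      tauto
    obtain ⟨B, hB, hBA⟩ := S.exists_mem_SO_of_pow_eq
      (A := ((algebraMap F K f)⁻¹ * t⁻¹) • A.val) (fun r m => by
        rw [mul_smul, Matrix.smul_apply, smul_eq_mul, mul_pow, hBpow, inv_pow, S.algebraMap_pow])
      (fun x => by
        rw [mul_smul, Matrix.smul_mulVec, quadForm_smul, hform, he, map_pow]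
        field_simp)
    exact ⟨B, hB, act_eq_of_smul hBA⟩

end ArtinSchreierPair
end RelHemi

/-! ### External lines and transitivity of the orthogonal group on them -/

namespace RelHemi

/-- In a finite field of characteristic two, the sum of two elements outside the image of the
Artin–Schreier map `s ↦ s² + s` lies in this image. -/
lemma exists_sq_add_self_eq_add {K : Type*} [Field K] [Finite K] [CharP K 2] {c d : K}
    (hc : ∀ s : K, s ^ 2 + s ≠ c) (hd : ∀ s : K, s ^ 2 + s ≠ d) : ∃ s : K, s ^ 2 + s = c + d := by
  let f : K →+ K :=
    { toFun := fun s => s ^ 2 + s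
      map_zero' := by simp
      map_add' := fun x y => by
        linear_combination x * y * (CharTwo.two_eq_zero : (2 : K) = 0) }
  have hker : Nat.card f.ker = 2 := by
    have : (f.ker : Set K) = {0, 1} := by
      ext s
      change s ^ 2 + s = 0 ↔ s = 0 ∨ s = 1
      rw [show s ^ 2 + s = s * (s + 1) by ring, mul_eq_zero, CharTwo.add_eq_zero]
    rw [← SetLike.coe_sort_coe, this, Nat.card_coe_set_eq, Set.ncard_pair zero_ne_one]
  have hidx : f.range.index = 2 := by
    have h1 := f.range.card_mul_index
    have h2 := f.ker.card_mul_index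
    rw [AddSubgroup.index_ker, hker] at h2
    have h3 : 0 < Nat.card f.range := Nat.card_pos
    nlinarith
  have := (AddSubgroup.add_mem_iff_of_index_two hidx (a := c) (b := d)).2
    ⟨fun ⟨s, hs⟩ => absurd hs (hc s), fun ⟨s, hs⟩ => absurd hs (hd s)⟩
  exact this

/-- The subspaces underlying external lines. -/
structure IsExternal (F : Type*) {K : Type*} [Field F] [Field K] [Algebra F K] (q : ℕ)
    (L : Submodule K (Fin 4 → K)) : Prop where
  finrank : Module.finrank K L = 2
  isotropic : ∀ x ∈ L, ∀ y ∈ L, polarForm x (conj q y) = 0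
  notMem : ∀ v : Fin 4 → F, v ≠ 0 → algebraMap F K ∘ v ∉ L

section

variable {F K : Type*} [Field F] [Field K] [Algebra F K] {q : ℕ}

lemma comp_algebraMap_ne_zero {v : Fin 4 → F} (hv : v ≠ 0) : algebraMap F K ∘ v ≠ 0 := by
  intro h
  refine hv (funext fun i => (map_eq_zero (algebraMap F K)).1 (congrFun h i))

lemma pointsOf_disjoint_iff (L : Submodule K (Fin 4 → K)) :
    Disjoint (pointsOf L) (sympPoints F K) ↔ ∀ v : Fin 4 → F, v ≠ 0 → algebraMap F K ∘ v ∉ L := by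
  rw [Set.disjoint_left]
  constructor
  · intro h v hv hvL
    have hv' := comp_algebraMap_ne_zero (K := K) hv
    refine h ((mk_mem_pointsOf hv').2 hvL) ⟨v, hv, ?_⟩
    rw [Projectivization.submodule_mk]
    exact Submodule.mem_span_singleton_self _
  · rintro h p hp ⟨v, hv, hvp⟩
    exact h v hv (hp hvp)

lemma mem_extLines_iff {ℓ : Set (Pt K)} :
    ℓ ∈ extLines F K q ↔ ∃ L, IsExternal F q L ∧ ℓ = pointsOf L := by
  constructor
  · rintro ⟨⟨L, h1, h2, rfl⟩, h3⟩
    exact ⟨L, ⟨h1, h2, (pointsOf_disjoint_iff L).1 h3⟩, rfl⟩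
  · rintro ⟨L, ⟨h1, h2, h3⟩, rfl⟩
    exact ⟨⟨L, h1, h2, rfl⟩, (pointsOf_disjoint_iff L).2 h3⟩

/-- The matrix with columns `x`, `y` and their conjugates. -/
def frame (q : ℕ) (x y : Fin 4 → K) : Matrix (Fin 4) (Fin 4) K :=
  Matrix.of fun i j => ![x, y, conj q x, conj q y] j i

lemma frame_mulVec (x y z : Fin 4 → K) :
    frame q x y *ᵥ z = z 0 • x + z 1 • y + z 2 • conj q x + z 3 • conj q y := by
  ext i
  simp [frame, Matrix.mulVec, dotProduct, Fin.sum_univ_four]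
  ring

end

namespace ArtinSchreierPair

variable {F K : Type*} [Field F] [Field K] [Algebra F K] [CharP F 2] [CharP K 2]
  {q : ℕ} {υ : K} {δ : F} (S : ArtinSchreierPair q υ δ)
include S

omit [CharP F 2] [CharP K 2] in
lemma conj_vec (a b : Fin 4 → F) :
    conj q (algebraMap F K ∘ a + υ • (algebraMap F K ∘ b)) =
      algebraMap F K ∘ a + (υ + 1) • (algebraMap F K ∘ b) := by
  rw [S.conj_add, conj_smul, S.conj_algebraMap, S.conj_algebraMap, S.upsilon_pow]

omit [CharP F 2] in
lemma polarForm_conj_vec (a b : Fin 4 → F) :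
    polarForm (algebraMap F K ∘ a + υ • (algebraMap F K ∘ b))
      (conj q (algebraMap F K ∘ a + υ • (algebraMap F K ∘ b))) =
      algebraMap F K (polarForm a b) := by
  rw [S.conj_vec]
  simp only [polarForm_add_left, polarForm_add_right, polarForm_smul_left, polarForm_smul_right,
    polarForm_algebraMap, polarForm_self, polarForm_comm b a]
  linear_combination υ * algebraMap F K (polarForm a b) * (CharTwo.two_eq_zero : (2 : K) = 0)

/-- A nonzero isotropic vector with no multiple over the subfield has a nonsingular component. -/
lemma singular_components {a b : Fin 4 → F} (hab : polarForm a b = 0)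
    (ha : quadForm δ a = 0) (hb : quadForm δ b = 0)
    (h0 : algebraMap F K ∘ a + υ • (algebraMap F K ∘ b) ≠ 0) :
    ∃ v : Fin 4 → F, v ≠ 0 ∧ ∃ s : K,
      algebraMap F K ∘ v = s • (algebraMap F K ∘ a + υ • (algebraMap F K ∘ b)) := by
  have hz : algebraMap F K ∘ (0 : Fin 4 → F) = 0 := by ext; simp
  have hυ : υ ≠ 0 := by
    rintro h
    have := S.upsilon_pow
    rw [h, S.zero_pow, zero_add] at this
    exact zero_ne_one this
  by_cases ha0 : a = 0
  · refine ⟨b, ?_, υ⁻¹, ?_⟩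
    · rintro rfl; apply h0; simp [ha0, hz]
    · rw [ha0, hz, zero_add, smul_smul, inv_mul_cancel₀ hυ, one_smul]
  · obtain ⟨c, rfl⟩ := exists_smul_eq_of_singular S.anisotropic ha hb hab ha0
    have hc : algebraMap F K ∘ (c • a) = algebraMap F K c • (algebraMap F K ∘ a) := by ext; simp
    have hf : algebraMap F K ∘ a + υ • (algebraMap F K ∘ (c • a)) =
        (1 + υ * algebraMap F K c) • (algebraMap F K ∘ a) := by
      rw [hc, smul_smul, add_smul, one_smul]
    rw [hf] at h0 ⊢
    refine ⟨a, ha0, (1 + υ * algebraMap F K c)⁻¹, ?_⟩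
    rw [smul_smul, inv_mul_cancel₀ (left_ne_zero_of_smul h0), one_smul]

/-- External lines are anisotropic for the quadratic form. -/
lemma quadForm_ne_zero {L : Submodule K (Fin 4 → K)} (hL : IsExternal F q L) {x : Fin 4 → K}
    (hx : x ∈ L) (hx0 : x ≠ 0) : quadForm (υ * (υ + 1)) x ≠ 0 := by
  intro hQ
  obtain ⟨a, b, rfl⟩ := S.exists_vec_decomp x
  have hab := hL.isotropic _ hx _ hx
  rw [S.polarForm_conj_vec, map_eq_zero] at hab
  rw [quadForm_vec S.algebraMap_delta, hab, map_zero, mul_zero, add_zero] at hQ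
  -- Since υ² = υ + δ, these are the coordinates of Q(x) in the basis 1, υ. Both vanish, so a and b
  -- are orthogonal singular vectors, and Witt index one puts a nonzero subfield vector on L.
  have h : algebraMap F K (quadForm δ a + δ * quadForm δ b) +
      υ * algebraMap F K (quadForm δ b) = 0 := by
    rw [map_add, map_mul, S.algebraMap_delta]
    linear_combination hQ + υ * algebraMap F K (quadForm δ b) *
      (CharTwo.two_eq_zero : (2 : K) = 0)
  obtain ⟨h1, h2⟩ := S.eq_zero_of_add_eq_zero h
  rw [h2, mul_zero, add_zero] at h1
  obtain ⟨v, hv, s, hs⟩ := S.singular_components hab h1 h2 hx0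
  exact hL.notMem v hv (hs ▸ L.smul_mem s hx)

/-- Choosing s with s² = Q(x)/Q(y) makes Q(x + sy) = 0, and L is anisotropic. The polar form is
therefore nondegenerate on L. -/
lemma exists_eq_smul {L : Submodule K (Fin 4 → K)} (hL : IsExternal F q L) {x y : Fin 4 → K}
    (hx : x ∈ L) (hy : y ∈ L) (hy0 : y ≠ 0) (hxy : polarForm x y = 0) : ∃ c : K, x = c • y := by
  have hQ := S.quadForm_ne_zero hL hy hy0
  obtain ⟨s, hs⟩ := S.sq_K (quadForm (υ * (υ + 1)) x / quadForm (υ * (υ + 1)) y)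
  refine ⟨s, ?_⟩
  by_contra hne
  refine S.quadForm_ne_zero hL (L.add_mem hx (L.smul_mem s hy))
    (fun h => hne (CharTwo.add_eq_zero.1 h)) ?_
  rw [quadForm_add, quadForm_smul, polarForm_smul_right, hxy, ← hs, div_mul_cancel₀ _ hQ,
    CharTwo.add_self_eq_zero, mul_zero, add_zero]

/-- Normalised bases of external lines. -/
lemma exists_normal_basis {L : Submodule K (Fin 4 → K)} (hL : IsExternal F q L) :
    ∃ x ∈ L, ∃ y ∈ L, quadForm (υ * (υ + 1)) x = 1 ∧ polarForm x y = 1 := by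
  obtain ⟨x, hx, hx0⟩ := L.exists_mem_ne_zero_of_ne_bot (by
    rintro rfl
    simpa using hL.finrank)
  obtain ⟨y, hy, hxy⟩ : ∃ y ∈ L, polarForm x y ≠ 0 := by
    by_contra! h
    have hle : L ≤ Submodule.span K {x} := fun y hy => by
      obtain ⟨c, rfl⟩ := S.exists_eq_smul hL hy hx hx0 ((polarForm_comm _ _).trans (h y hy))
      exact Submodule.smul_mem _ _ (Submodule.mem_span_singleton_self x)
    have h1 := Submodule.finrank_mono hle
    rw [hL.finrank, finrank_span_singleton hx0] at h1
    omega
  obtain ⟨s, hs⟩ := S.sq_K (quadForm (υ * (υ + 1)) x)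
  have hs0 : s ≠ 0 := by
    rintro rfl
    exact S.quadForm_ne_zero hL hx hx0 (by rw [hs]; ring)
  refine ⟨s⁻¹ • x, L.smul_mem _ hx, (s * (polarForm x y)⁻¹) • y, L.smul_mem _ hy, ?_, ?_⟩
  · rw [quadForm_smul, hs]; field_simp
  · rw [polarForm_smul_left, polarForm_smul_right]; field_simp

lemma eq_span {L : Submodule K (Fin 4 → K)} (hL : IsExternal F q L) {x y : Fin 4 → K}
    (hx : x ∈ L) (hy : y ∈ L) (hxy : polarForm x y = 1) : L = Submodule.span K {x, y} := by
  refine le_antisymm (fun z hz => ?_) (Submodule.span_le.2 ?_)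
  · have hy0 : y ≠ 0 := by rintro rfl; simp [polarForm] at hxy
    obtain ⟨c, hc⟩ := S.exists_eq_smul hL
      (L.add_mem (L.add_mem hz (L.smul_mem (polarForm z y) hx)) (L.smul_mem (polarForm x z) hy))
      hy hy0 (by
        rw [polarForm_add_left, polarForm_add_left, polarForm_smul_left, polarForm_smul_left, hxy,
          polarForm_self]
        linear_combination polarForm z y * (CharTwo.two_eq_zero : (2 : K) = 0))
    refine Submodule.mem_span_pair.2 ⟨-polarForm z y, c - polarForm x z, ?_⟩
    rw [sub_smul, neg_smul, ← hc]
    abel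
  · rintro z (rfl | rfl)
    exacts [hx, hy]

section Frames

variable {L : Submodule K (Fin 4 → K)} (hL : IsExternal F q L) {x y : Fin 4 → K}
include hL

omit S [CharP F 2] [CharP K 2] in
lemma polarForm_conj_right {x y : Fin 4 → K} (hx : x ∈ L) (hy : y ∈ L) :
    polarForm x (conj q y) = 0 ∧ polarForm (conj q y) x = 0 :=
  ⟨hL.isotropic x hx y hy, (polarForm_comm _ _).trans (hL.isotropic x hx y hy)⟩

omit [CharP F 2] in
-- Hermitian isotropy of L says that L and its conjugate are orthogonal for the polar form, so no
-- mixed terms appear. In a normalised frame the form depends only on Q(y), and equal values allow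
-- two frames to be matched isometrically.
lemma quadForm_frame (hx : x ∈ L) (hy : y ∈ L) (hQ : quadForm (υ * (υ + 1)) x = 1)
    (hxy : polarForm x y = 1) (z : Fin 4 → K) :
    quadForm (υ * (υ + 1)) (frame q x y *ᵥ z) =
      z 0 ^ 2 + z 1 ^ 2 * quadForm (υ * (υ + 1)) y + z 0 * z 1 +
        (z 2 ^ 2 + z 3 ^ 2 * quadForm (υ * (υ + 1)) y ^ q + z 2 * z 3) := by
  have h1 : polarForm (conj q x) (conj q y) = 1 := by rw [S.polarForm_conj, hxy, one_pow]
  have h2 : quadForm (υ * (υ + 1)) (conj q x) = 1 := by rw [S.quadForm_conj, hQ, one_pow]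
  rw [frame_mulVec]
  simp only [quadForm_add, quadForm_smul, polarForm_add_left, polarForm_smul_left,
    polarForm_smul_right, hQ, hxy, h1, h2, (polarForm_conj_right hL hx hx).1,
    (polarForm_conj_right hL hx hy).1, (polarForm_conj_right hL hy hx).1,
    (polarForm_conj_right hL hy hy).1, S.quadForm_conj]
  ring

omit [CharP F 2] in
-- Pairing a combination of the frame with its four vectors recovers the coefficients.
lemma frame_injective (hx : x ∈ L) (hy : y ∈ L) (hxy : polarForm x y = 1) {z : Fin 4 → K}
    (h : frame q x y *ᵥ z = 0) : z = 0 := by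
  have h1 : polarForm (conj q x) (conj q y) = 1 := by rw [S.polarForm_conj, hxy, one_pow]
  rw [frame_mulVec] at h
  have key : ∀ w, polarForm (z 0 • x + z 1 • y + z 2 • conj q x + z 3 • conj q y) w = 0 := by
    intro w; rw [h]; simp [polarForm]
  have ey := key y
  have ex := key x
  have ecy := key (conj q y)
  have ecx := key (conj q x)
  simp only [polarForm_add_left, polarForm_smul_left, polarForm_self, hxy, h1,
    (polarForm_comm y x).trans hxy, (polarForm_comm _ _).trans h1,
    (polarForm_conj_right hL hx hx).1, (polarForm_conj_right hL hx hy).1,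
    (polarForm_conj_right hL hy hx).1, (polarForm_conj_right hL hy hy).1,
    (polarForm_conj_right hL hx hx).2, (polarForm_conj_right hL hx hy).2,
    (polarForm_conj_right hL hy hx).2, (polarForm_conj_right hL hy hy).2,
    mul_zero, mul_one, add_zero, zero_add] at ex ey ecx ecy
  ext i
  fin_cases i
  exacts [ey, ex, ecy, ecx]

omit [CharP F 2] in
lemma isUnit_frame (hx : x ∈ L) (hy : y ∈ L) (hxy : polarForm x y = 1) :
    IsUnit (frame q x y) :=
  Matrix.mulVec_injective_iff_isUnit.1 fun u v h => sub_eq_zero.1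
    (S.frame_injective hL hx hy hxy (by rw [Matrix.mulVec_sub, sub_eq_zero]; exact h))

end Frames

omit [CharP F 2] in
lemma conj_frame_mulVec (x y z : Fin 4 → K) :
    conj q (frame q x y *ᵥ z) = frame q x y *ᵥ ![z 2 ^ q, z 3 ^ q, z 0 ^ q, z 1 ^ q] := by
  simp only [frame_mulVec, S.conj_add, conj_smul, S.conj_conj]
  simp
  abel

omit [CharP F 2] [CharP K 2] in
/-- A matrix commuting with conjugation has entries fixed by the Frobenius map. -/
lemma entries_pow_eq {A : Matrix (Fin 4) (Fin 4) K}
    (hA : ∀ z, conj q (A *ᵥ z) = A *ᵥ conj q z) (i j : Fin 4) : A i j ^ q = A i j := by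
  have h := congrFun (hA (Pi.single j 1)) i
  have hs : conj q (Pi.single j 1 : Fin 4 → K) = Pi.single j 1 := by
    ext m
    by_cases hm : m = j
    · subst hm; simp [conj]
    · simp [conj, hm, S.zero_pow]
  rw [hs] at h
  simpa [conj] using h

/-- The orthogonal group is transitive on external lines. -/
lemma exists_mem_PSO_smul_eq [Finite K] {ℓ m : Set (Pt K)} (hℓ : ℓ ∈ extLines F K q)
    (hm : m ∈ extLines F K q) : ∃ g ∈ PSO K δ, g • ℓ = m := by
  obtain ⟨L, hL, rfl⟩ := mem_extLines_iff.1 hℓ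
  obtain ⟨M, hM, rfl⟩ := mem_extLines_iff.1 hm
  obtain ⟨x, hx, y, hy, hQx, hxy⟩ := S.exists_normal_basis hL
  obtain ⟨u, hu, w, hw, hQu, huw⟩ := S.exists_normal_basis hM
  -- Q(sa + b) = s² + s + Q(b) cannot vanish on an external line, so Q(b) lies outside the
  -- Artin–Schreier image.
  have out : ∀ {N : Submodule K (Fin 4 → K)}, IsExternal F q N → ∀ {a b : Fin 4 → K}, a ∈ N →
      b ∈ N → quadForm (υ * (υ + 1)) a = 1 → polarForm a b = 1 →
      ∀ s, s ^ 2 + s ≠ quadForm (υ * (υ + 1)) b := by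
    intro N hN a b ha hb hQ hab s hs
    refine S.quadForm_ne_zero hN (N.add_mem (N.smul_mem s ha) hb) ?_ ?_
    · intro h
      have h' : polarForm a (s • a + b) = 0 := by rw [h]; simp [polarForm]
      rw [polarForm_add_right, polarForm_smul_right, polarForm_self, hab] at h'
      simp at h'
    · rw [quadForm_add, quadForm_smul, polarForm_smul_left, hQ, hab, ← hs]
      linear_combination (s ^ 2 + s) * (CharTwo.two_eq_zero : (2 : K) = 0)
  obtain ⟨s, hs⟩ := exists_sq_add_self_eq_add (out hL hx hy hQx hxy) (out hM hu hw hQu huw)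
  have hw' : s • u + w ∈ M := M.add_mem (M.smul_mem s hu) hw
  have huw' : polarForm u (s • u + w) = 1 := by
    rw [polarForm_add_right, polarForm_smul_right, polarForm_self, huw]; ring
  have hQw' : quadForm (υ * (υ + 1)) (s • u + w) = quadForm (υ * (υ + 1)) y := by
    rw [quadForm_add, quadForm_smul, polarForm_smul_left, hQu, huw]
    linear_combination hs + quadForm (υ * (υ + 1)) w * (CharTwo.two_eq_zero : (2 : K) = 0)
  generalize s • u + w = w' at hw' huw' hQw'
  have hP := S.isUnit_frame hL hx hy hxy
  obtain ⟨P, hP⟩ := hP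
  -- The map carrying one frame to the other. Conjugation permutes both frames in the same way, so T
  -- commutes with it and has entries in the subfield.
  set T : Matrix (Fin 4) (Fin 4) K := frame q u w' * P⁻¹.val with hT
  have hTP : ∀ z, T *ᵥ (frame q x y *ᵥ z) = frame q u w' *ᵥ z := by
    intro z
    rw [hT, ← hP, Matrix.mulVec_mulVec, Matrix.mul_assoc, Units.inv_mul, Matrix.mul_one]
  have hsurj : ∀ z, ∃ z', z = frame q x y *ᵥ z' := fun z =>
    ⟨P⁻¹.val *ᵥ z, by rw [← hP, mulVecLin_inv_apply]⟩
  obtain ⟨A, hA, hAT⟩ := S.exists_mem_SO_of_pow_eq (A := T)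
    (S.entries_pow_eq fun z => by
      obtain ⟨z, rfl⟩ := hsurj z
      rw [hTP, S.conj_frame_mulVec, S.conj_frame_mulVec, hTP])
    (fun z => by
      obtain ⟨z, rfl⟩ := hsurj z
      rw [hTP, S.quadForm_frame hL hx hy hQx hxy, S.quadForm_frame hM hu hw' hQu huw', hQw'])
  refine ⟨subfieldAction F K A, ⟨A, hA, rfl⟩, ?_⟩
  refine (smul_pointsOf _ _).trans (congrArg _ ?_)
  have e0 : T *ᵥ x = u := by simpa [frame_mulVec] using hTP ![1, 0, 0, 0]
  have e1 : T *ᵥ y = w' := by simpa [frame_mulVec] using hTP ![0, 1, 0, 0]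
  rw [hAT, S.eq_span hL hx hy hxy, S.eq_span hM hu hw' huw', Submodule.map_span, Set.image_pair,
    Matrix.mulVecLin_apply, Matrix.mulVecLin_apply, e0, e1]

omit [CharP F 2] in
lemma conj_reflection (v x : Fin 4 → K) :
    conj q (reflection (υ * (υ + 1)) v x) = reflection (υ * (υ + 1)) (conj q v) (conj q x) := by
  rw [reflection_eq, reflection_eq, S.conj_add, conj_smul, S.polarForm_conj, S.quadForm_conj,
    div_pow]

end ArtinSchreierPair

/-! ### Evenness of line stabilisers, and odd elements fixing external points -/

/-- Isometries over the big field that stabilise `L` and commute with conjugation on it. -/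
structure IsAdapted {K : Type*} [Field K] (q : ℕ) (υ : K) (L : Submodule K (Fin 4 → K))
    (g : GL (Fin 4) K) : Prop where
  isometry : ∀ x, quadForm (υ * (υ + 1)) (g.val *ᵥ x) = quadForm (υ * (υ + 1)) x
  mem : ∀ x ∈ L, g.val *ᵥ x ∈ L
  conj : ∀ x ∈ L, g.val *ᵥ conj q x = conj q (g.val *ᵥ x)

namespace ArtinSchreierPair

variable {F K : Type*} [Field F] [Field K] [Algebra F K] [CharP F 2] [CharP K 2]
  {q : ℕ} {υ : K} {δ : F} (S : ArtinSchreierPair q υ δ)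
include S

/-- Compose g with the reflections in v = gu + u and in its conjugate. The second acts trivially on
L and the first on the conjugate of L, so on L the product is g followed by the reflection in v, and
compatibility with conjugation survives. Two reflections are used, so the effect on the rulings is
unchanged. -/
lemma exists_isAdapted_fixing {L : Submodule K (Fin 4 → K)} (hL : IsExternal F q L)
    {g : GL (Fin 4) K} (hg : IsAdapted q υ L g) {u : Fin 4 → K} (hu : u ∈ L) :
    ∃ g', IsAdapted q υ L g' ∧ g'.val *ᵥ u = u ∧ (∀ z ∈ L, g.val *ᵥ z = z → g'.val *ᵥ z = z) ∧
      (act g' • ruling₁ υ = ruling₁ υ → act g • ruling₁ υ = ruling₁ υ) := by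
  by_cases h : g.val *ᵥ u = u
  · exact ⟨g, hg, h, fun _ _ => id, id⟩
  set v := g.val *ᵥ u + u with hv
  have hvL : v ∈ L := L.add_mem (hg.mem u hu) hu
  have hQv : quadForm (υ * (υ + 1)) v ≠ 0 :=
    S.quadForm_ne_zero hL hvL fun h' => h (CharTwo.add_eq_zero.1 h')
  have hQcv : quadForm (υ * (υ + 1)) (RelHemi.conj q v) ≠ 0 := by
    rw [S.quadForm_conj]
    exact pow_ne_zero _ hQv
  have onL : ∀ z ∈ L, (reflectionGL (υ * (υ + 1)) v * reflectionGL (υ * (υ + 1))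
      (RelHemi.conj q v) * g).val *ᵥ z = reflection (υ * (υ + 1)) v (g.val *ᵥ z) := by
    intro z hz
    rw [Units.val_mul, Units.val_mul, ← Matrix.mulVec_mulVec, ← Matrix.mulVec_mulVec,
      reflectionGL_mulVec, reflectionGL_mulVec,
      reflection_of_polarForm_eq_zero _ (hL.isotropic _ (hg.mem z hz) v hvL)]
  have reflL : ∀ z ∈ L, reflection (υ * (υ + 1)) v z ∈ L := fun z hz => by
    rw [reflection_eq]
    exact L.add_mem hz (L.smul_mem _ hvL)
  refine ⟨reflectionGL (υ * (υ + 1)) v * reflectionGL (υ * (υ + 1)) (RelHemi.conj q v) * g,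
    ⟨fun x => ?_, fun z hz => ?_, fun z hz => ?_⟩, ?_, ?_, ?_⟩
  · rw [Units.val_mul, Units.val_mul, ← Matrix.mulVec_mulVec, ← Matrix.mulVec_mulVec,
      reflectionGL_mulVec, reflectionGL_mulVec, quadForm_reflection hQv, quadForm_reflection hQcv,
      hg.isometry]
  · rw [onL z hz]
    exact reflL _ (hg.mem z hz)
  · rw [onL z hz, Units.val_mul, Units.val_mul, ← Matrix.mulVec_mulVec, ← Matrix.mulVec_mulVec,
      reflectionGL_mulVec, reflectionGL_mulVec, hg.conj z hz, ← S.conj_reflection]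
    exact reflection_of_polarForm_eq_zero _
      ((polarForm_comm _ _).trans (hL.isotropic _ hvL _ (reflL _ (hg.mem z hz))))
  · rw [onL u hu]
    exact reflection_add_left (hg.isometry u) hQv
  · intro z hz hgz
    rw [onL z hz, hgz]
    refine reflection_of_polarForm_eq_zero _ ?_
    have := polarForm_of_quadForm hg.isometry z u
    rw [hgz] at this
    rw [hv, polarForm_add_right, this, CharTwo.add_self_eq_zero]
  · intro h'
    rw [map_mul, map_mul, mul_smul, mul_smul] at h'
    have h2 := congrArg (act (reflectionGL (υ * (υ + 1)) (RelHemi.conj q v)) • ·)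
      (congrArg (act (reflectionGL (υ * (υ + 1)) v) • ·) h')
    simp only [act_reflectionGL_smul_smul] at h2
    rw [h2, reflectionGL_smul_ruling₁ hQv, reflectionGL_smul_ruling₂ hQcv]

/-- Isometries stabilising an external line are even. -/
lemma mem_POmega_of_smul_eq {ℓ : Set (Pt K)} (hℓ : ℓ ∈ extLines F K q) {g : Equiv.Perm (Pt K)}
    (hg : g ∈ PSO K δ) (h : g • ℓ = ℓ) : g ∈ POmega K δ := by
  rw [mem_POmega_iff S.algebraMap_delta S.anisotropic hg]
  obtain ⟨L, hL, rfl⟩ := mem_extLines_iff.1 hℓ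
  obtain ⟨A, hA, rfl⟩ := hg
  have hmap := pointsOf_injective ((smul_pointsOf _ _).symm.trans h)
  have had : IsAdapted q υ L (Matrix.GeneralLinearGroup.map (algebraMap F K) A) := by
    refine ⟨S.quadForm_map_mulVec hA, fun x hx => ?_, fun x _ => (S.conj_map_mulVec A x).symm⟩
    rw [← hmap]
    exact Submodule.mem_map_of_mem hx
  obtain ⟨x, hx, y, hy, -, hxy⟩ := S.exists_normal_basis hL
  obtain ⟨g₁, had₁, h₁, -, hr₁⟩ := S.exists_isAdapted_fixing hL had hx
  obtain ⟨g₂, had₂, h₂, hf₂, hr₂⟩ := S.exists_isAdapted_fixing hL had₁ hy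
  refine hr₁ (hr₂ ?_)
  have hx₂ := hf₂ x hx h₁
  -- After two corrections x and y are fixed, hence so are their conjugates, and these four vectors
  -- span.
  suffices g₂ = 1 by rw [this, map_one, one_smul]
  obtain ⟨P, hP⟩ := S.isUnit_frame hL hx hy hxy
  refine Units.ext (Matrix.ext_of_mulVec_single fun i => ?_)
  rw [Units.val_one, Matrix.one_mulVec, ← mulVecLin_inv_apply P (Pi.single i 1), hP, frame_mulVec]
  simp only [Matrix.mulVec_add, Matrix.mulVec_smul, had₂.conj x hx, had₂.conj y hy, hx₂, h₂]

omit [CharP F 2] in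
/-- External lines exist. -/
lemma extLines_nonempty : (extLines F K q).Nonempty := by
  have h0 : (2 : K) = 0 := CharTwo.two_eq_zero
  -- Coordinates 0 and 3 read off the coefficients of a combination. For a vector over the subfield
  -- the other two coordinates then force both coefficients to be zero, because 1 and υ are
  -- independent.
  refine ⟨_, mem_extLines_iff.2
    ⟨Submodule.span K {![1, 0, υ, 0], ![0, υ + 1, 0, 1]}, ⟨?_, ?_, ?_⟩, rfl⟩⟩
  · have hli : LinearIndependent K ![(![1, 0, υ, 0] : Fin 4 → K), ![0, υ + 1, 0, 1]] := by
      refine LinearIndependent.pair_iff.2 fun s t h => ?_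
      have e0 := congrFun h 0
      have e3 := congrFun h 3
      simp at e0 e3
      exact ⟨e0, e3⟩
    have := finrank_span_eq_card hli
    rwa [Matrix.range_cons_cons_empty] at this
  · intro x hx y hy
    obtain ⟨a, b, rfl⟩ := Submodule.mem_span_pair.1 hx
    obtain ⟨c, d, rfl⟩ := Submodule.mem_span_pair.1 hy
    have h2 : (υ + 1) ^ q = υ := by
      rw [S.add_pow, S.upsilon_pow, one_pow]
      linear_combination h0
    rw [S.conj_add, conj_smul, conj_smul]
    simp [polarForm, conj, h2, S.zero_pow, S.upsilon_pow]
    linear_combination (a * d ^ q * υ + b * c ^ q * (υ + 1)) * h0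
  · intro v hv hmem
    obtain ⟨a, b, h⟩ := Submodule.mem_span_pair.1 hmem
    have e0 := congrFun h 0
    have e1 := congrFun h 1
    have e2 := congrFun h 2
    have e3 := congrFun h 3
    simp at e0 e1 e2 e3
    rw [e0] at e2
    rw [e3] at e1
    obtain ⟨h2, h3⟩ := S.eq_zero_of_add_eq_zero (a := -v 2) (b := v 0) (by
      rw [map_neg]; linear_combination e2)
    obtain ⟨h4, h5⟩ := S.eq_zero_of_add_eq_zero (a := v 3 - v 1) (b := v 3) (by
      rw [map_sub]; linear_combination e1)
    refine hv (funext fun i => ?_)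
    fin_cases i
    · exact h3
    · simpa [h5] using h4
    · simpa using h2
    · exact h5

/-- Every external point is fixed by a reflection. -/
lemma exists_reflection_smul_eq {P : Pt K} (hP : P ∈ extPoints F K q) :
    ∃ v : Fin 4 → F, quadForm δ v ≠ 0 ∧ subfieldAction F K (reflectionGL δ v) • P = P := by
  obtain ⟨hH, hW⟩ := hP
  induction P using Projectivization.ind with | _ x hx =>
  have hxm : x ∈ (Projectivization.mk K x hx).submodule := by
    rw [Projectivization.submodule_mk]
    exact Submodule.mem_span_singleton_self x
  have hxx := hH x hxm
  obtain ⟨a, b, rfl⟩ := S.exists_vec_decomp x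
  rw [hermForm_eq, S.polarForm_conj_vec, map_eq_zero] at hxx
  have key : ∀ v : Fin 4 → F, polarForm a v = 0 → polarForm b v = 0 →
      subfieldAction F K (reflectionGL δ v) • Projectivization.mk K _ hx =
        Projectivization.mk K _ hx := by
    intro v hav hbv
    rw [subfieldAction_reflectionGL]
    change reflectionGL (algebraMap F K δ) (algebraMap F K ∘ v) • Projectivization.mk K _ hx = _
    rw [Projectivization.smul_mk]
    congr 1
    change (reflectionGL (algebraMap F K δ) (algebraMap F K ∘ v)).val *ᵥ _ = _
    rw [reflectionGL_mulVec]
    refine reflection_of_polarForm_eq_zero _ ?_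
    rw [polarForm_add_left, polarForm_smul_left, polarForm_algebraMap, polarForm_algebraMap, hav,
      hbv]
    simp
  -- As a and b are orthogonal, reflection in whichever is nonsingular fixes both. If both are
  -- singular the point lies in W(3, q).
  by_cases ha : quadForm δ a = 0
  · by_cases hb : quadForm δ b = 0
    · obtain ⟨v, hv, s, hs⟩ := S.singular_components hxx ha hb hx
      refine absurd ⟨v, hv, ?_⟩ hW
      change algebraMap F K ∘ v ∈ _
      rw [hs]
      exact Submodule.smul_mem _ _ hxm
    · exact ⟨b, hb, key b hxx (polarForm_self b)⟩
  · exact ⟨a, ha, key a (polarForm_self a) ((polarForm_comm _ _).trans hxx)⟩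

end ArtinSchreierPair
end RelHemi

/-! ### Transitive actions with all point stabilisers in a subgroup of index two -/

namespace RelHemi

lemma mem_orbit_subgroup {Γ X : Type*} [Group Γ] [MulAction Γ X] {G : Subgroup Γ} {x y : X} :
    y ∈ MulAction.orbit G x ↔ ∃ g ∈ G, g • x = y :=
  ⟨fun ⟨g, hg⟩ => ⟨g, g.2, hg⟩, fun ⟨g, hg, h⟩ => ⟨⟨g, hg⟩, h⟩⟩

lemma mul_mem_iff_of_relIndex {Γ : Type*} [Group Γ] {G H : Subgroup Γ} (h : G.relIndex H = 2)
    {a b : Γ} (ha : a ∈ H) (hb : b ∈ H) : a * b ∈ G ↔ (a ∈ G ↔ b ∈ G) :=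
  Subgroup.mul_mem_iff_of_index_two (H := G.subgroupOf H) h (a := ⟨a, ha⟩) (b := ⟨b, hb⟩)

lemma smul_set_eq_of_forall_subset {Γ X : Type*} [Group Γ] [MulAction Γ X] {H : Subgroup Γ}
    {s : Set X} (h : ∀ g ∈ H, ∀ x ∈ s, g • x ∈ s) {g : Γ} (hg : g ∈ H) : g • s = s := by
  refine Set.Subset.antisymm ?_ fun x hx => ?_
  · rintro _ ⟨x, hx, rfl⟩
    exact h g hg x hx
  · exact Set.mem_smul_set_iff_inv_smul_mem.2 (h _ (inv_mem hg) x hx)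

/-- A transitive action of `H` on `S` all of whose point stabilisers lie in the subgroup `G` of
index two. -/
structure IndexTwoTransitive {Γ X : Type*} [Group Γ] [MulAction Γ X] (G H : Subgroup Γ)
    (S : Set X) : Prop where
  le : G ≤ H
  index_two : G.relIndex H = 2
  smul_mem : ∀ g ∈ H, ∀ x ∈ S, g • x ∈ S
  transitive : ∀ x ∈ S, ∀ y ∈ S, ∃ g ∈ H, g • x = y
  stabilizer : ∀ x ∈ S, ∀ g ∈ H, g • x = x → g ∈ G
  nonempty : S.Nonempty

namespace IndexTwoTransitive

variable {Γ X : Type*} [Group Γ] [MulAction Γ X] {G H : Subgroup Γ} {S : Set X}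
  (T : IndexTwoTransitive G H S)
include T

/-- If g and h in G send x to the same point, then h⁻¹g stabilises x and so lies in G. Parity thus
becomes visible on orbits. -/
lemma smul_mem_orbit_iff {x : X} (hx : x ∈ S) {g : Γ} (hg : g ∈ H) :
    g • x ∈ MulAction.orbit G x ↔ g ∈ G := by
  rw [mem_orbit_subgroup]
  constructor
  · rintro ⟨h, hh, he⟩
    have h1 : h⁻¹ * g ∈ G := T.stabilizer x hx _ (mul_mem (inv_mem (T.le hh)) hg) (by
      rw [mul_smul, ← he, inv_smul_smul])
    exact (Subgroup.mul_mem_cancel_left G (inv_mem hh)).1 h1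
  · exact fun h => ⟨g, h, rfl⟩

/-- This is normality of G in H, obtained from the parity rule for products. -/
lemma smul_orbit {g : Γ} (hg : g ∈ H) (x : X) :
    g • MulAction.orbit G x = MulAction.orbit G (g • x) := by
  ext y
  rw [Set.mem_smul_set_iff_inv_smul_mem, mem_orbit_subgroup, mem_orbit_subgroup]
  constructor
  · rintro ⟨h, hh, he⟩
    refine ⟨g * h * g⁻¹, ?_, ?_⟩
    · have hH := T.le hh
      rw [mul_mem_iff_of_relIndex T.index_two (mul_mem hg hH) (inv_mem hg),
        mul_mem_iff_of_relIndex T.index_two hg hH, inv_mem_iff]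
      tauto
    · rw [mul_smul, mul_smul, inv_smul_smul, he, smul_inv_smul]
  · rintro ⟨h, hh, he⟩
    refine ⟨g⁻¹ * h * g, ?_, ?_⟩
    · have hH := T.le hh
      rw [mul_mem_iff_of_relIndex T.index_two (mul_mem (inv_mem hg) hH) hg,
        mul_mem_iff_of_relIndex T.index_two (inv_mem hg) hH, inv_mem_iff]
      tauto
    · rw [mul_smul, mul_smul, he]

lemma smul_orbit_eq_iff {g : Γ} (hg : g ∈ H) {x : X} (hx : x ∈ S) :
    g • MulAction.orbit G x = MulAction.orbit G x ↔ g ∈ G := by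
  rw [T.smul_orbit hg, ← T.smul_mem_orbit_iff hx hg]
  exact MulAction.orbit_eq_iff

lemma exists_odd : ∃ r ∈ H, r ∉ G := by
  obtain ⟨r, hr, hr', -⟩ := Subgroup.relIndex_eq_two_iff_exists_notMem_and.1 T.index_two
  exact ⟨r, hr, hr'⟩

lemma lt : G < H := by
  obtain ⟨r, hr, hr'⟩ := T.exists_odd
  exact lt_of_le_of_ne T.le fun h => hr' (h ▸ hr)

lemma actsSemiregularly : ActsSemiregularly H (orbitsOn G S) := by
  rintro g hg ⟨_, ⟨x, hx, rfl⟩, he⟩ _ ⟨y, hy, rfl⟩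
  rw [T.smul_orbit_eq_iff hg hx] at he
  rwa [T.smul_orbit_eq_iff hg hy]

lemma kernel {g : Γ} (hg : g ∈ H) : (∀ O ∈ orbitsOn G S, g • O = O) ↔ g ∈ G := by
  obtain ⟨x, hx⟩ := T.nonempty
  refine ⟨fun h => (T.smul_orbit_eq_iff hg hx).1 (h _ ⟨x, hx, rfl⟩), ?_⟩
  rintro h _ ⟨y, hy, rfl⟩
  rwa [T.smul_orbit_eq_iff hg hy]

/-- Two points of `S` lie in the same `G`-orbit, or an odd element maps one orbit to the other. -/
lemma mem_orbit_or {x y : X} (hx : x ∈ S) (hy : y ∈ S) {r : Γ} (hr : r ∈ H) (hr' : r ∉ G) :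
    y ∈ MulAction.orbit G x ∨ y ∈ r • MulAction.orbit G x := by
  obtain ⟨g, hg, rfl⟩ := T.transitive x hx y hy
  rw [T.smul_mem_orbit_iff hx hg, Set.mem_smul_set_iff_inv_smul_mem, smul_smul,
    T.smul_mem_orbit_iff hx (mul_mem (inv_mem hr) hg),
    mul_mem_iff_of_relIndex T.index_two (inv_mem hr) hg, inv_mem_iff]
  tauto

lemma disjoint_smul_orbit {x : X} (hx : x ∈ S) {r : Γ} (hr : r ∈ H) (hr' : r ∉ G) :
    Disjoint (MulAction.orbit G x) (r • MulAction.orbit G x) := by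
  rw [Set.disjoint_left]
  intro y h1 h2
  obtain ⟨g, hg, rfl⟩ := mem_orbit_subgroup.1 h1
  rw [Set.mem_smul_set_iff_inv_smul_mem, smul_smul,
    T.smul_mem_orbit_iff hx (mul_mem (inv_mem hr) (T.le hg)),
    mul_mem_iff_of_relIndex T.index_two (inv_mem hr) (T.le hg), inv_mem_iff] at h2
  tauto

lemma orbit_subset {x : X} (hx : x ∈ S) : MulAction.orbit G x ⊆ S := by
  intro y hy
  obtain ⟨g, hg, rfl⟩ := mem_orbit_subgroup.1 hy
  exact T.smul_mem g (T.le hg) x hx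

lemma ncard_orbitsOn : (orbitsOn G S).ncard = 2 := by
  obtain ⟨x, hx⟩ := T.nonempty
  obtain ⟨r, hr, hr'⟩ := T.exists_odd
  have hne : MulAction.orbit G x ≠ MulAction.orbit G (r • x) := by
    rw [← T.smul_orbit hr]
    exact fun h => hr' ((T.smul_orbit_eq_iff hr hx).1 h.symm)
  rw [← Set.ncard_pair hne]
  congr 1
  ext O
  constructor
  · rintro ⟨y, hy, rfl⟩
    refine (T.mem_orbit_or hx hy hr hr').imp (fun h => MulAction.orbit_eq_iff.2 h) fun h => ?_
    rw [T.smul_orbit hr] at h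
    exact MulAction.orbit_eq_iff.2 h
  · rintro (rfl | rfl)
    exacts [⟨x, hx, rfl⟩, ⟨_, T.smul_mem r hr x hx, rfl⟩]

/-- The unions of `G`-orbits of representatives of the `H`-orbits on `S` are the `G`-orbits. -/
lemma exists_representatives_iff (R : Set X) :
    (∃ Y ⊆ S, (∀ x ∈ S, ∃! m, m ∈ Y ∧ m ∈ MulAction.orbit H x) ∧
      R = ⋃ x ∈ Y, MulAction.orbit G x) ↔ R ∈ orbitsOn G S := by
  constructor
  · rintro ⟨Y, hY, h, rfl⟩
    obtain ⟨x, hx⟩ := T.nonempty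
    obtain ⟨m, ⟨hm, -⟩, huniq⟩ := h x hx
    -- Since H has a single orbit on S, a set of representatives has one element.
    have hYm : Y = {m} := by
      ext y
      refine ⟨fun hy => ?_, fun hy => hy ▸ hm⟩
      exact huniq y ⟨hy, mem_orbit_subgroup.2 (T.transitive x hx y (hY hy))⟩
    exact ⟨m, hY hm, by simp [hYm]⟩
  · rintro ⟨x, hx, rfl⟩
    refine ⟨{x}, by simpa using hx, fun y hy => ⟨x, ⟨rfl, ?_⟩, fun m hm => hm.1⟩, by simp⟩
    exact mem_orbit_subgroup.2 (T.transitive y hy x hx)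

omit T in
/-- If every point of `P` is fixed by an odd element, then `G` and `H` have the same orbits
on `P`. -/
lemma orbitsOn_eq {Y : Type*} [MulAction Γ Y] {P : Set Y} (hle : G ≤ H) (hidx : G.relIndex H = 2)
    (hP : ∀ p ∈ P, ∃ r ∈ H, r ∉ G ∧ r • p = p) : orbitsOn H P = orbitsOn G P := by
  have key : ∀ p ∈ P, MulAction.orbit H p = MulAction.orbit G p := by
    intro p hp
    ext y
    rw [mem_orbit_subgroup, mem_orbit_subgroup]
    constructor
    · rintro ⟨g, hg, rfl⟩
      by_cases hgG : g ∈ G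
      · exact ⟨g, hgG, rfl⟩
      · obtain ⟨r, hr, hr', hrp⟩ := hP p hp
        refine ⟨g * r, ?_, by rw [mul_smul, hrp]⟩
        rw [mul_mem_iff_of_relIndex hidx hg hr]
        tauto
    · rintro ⟨g, hg, rfl⟩
      exact ⟨g, hle hg, rfl⟩
  ext O
  exact exists_congr fun p => and_congr_right fun hp => by rw [key p hp]

end IndexTwoTransitive

/-! ### Application to PΩ⁻(4, q) and PSO⁻(4, q) -/

lemma act_smul_projLines {K : Type*} [Field K] (A : GL (Fin 4) K) {ℓ : Set (Pt K)}
    (h : ℓ ∈ projLines K) : act A • ℓ ∈ projLines K := by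
  obtain ⟨L, hL, rfl⟩ := h
  exact ⟨_, ((Submodule.equivMapOfInjective _ (mulVec_injective A) L).finrank_eq).symm.trans hL,
    smul_pointsOf A L⟩

lemma act_smul_hermLines {K : Type*} [Field K] {q : ℕ} {A : GL (Fin 4) K} (hA : A ∈ GU K q)
    {ℓ : Set (Pt K)} (h : ℓ ∈ hermLines K q) : act A • ℓ ∈ hermLines K q := by
  obtain ⟨L, hL, hiso, rfl⟩ := h
  refine ⟨_, ((Submodule.equivMapOfInjective _ (mulVec_injective A) L).finrank_eq).symm.trans hL,
    ?_, smul_pointsOf A L⟩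
  rintro _ ⟨x, hx, rfl⟩ _ ⟨y, hy, rfl⟩
  exact (hA x y).trans (hiso x hx y hy)

namespace ArtinSchreierPair

variable {F K : Type*} [Field F] [Field K] [Algebra F K] [CharP F 2] [CharP K 2]
  {q : ℕ} {υ : K} {δ : F} (S : ArtinSchreierPair q υ δ)

omit [CharP F 2] [CharP K 2] in
lemma PSO_smul_sympPoints {g : Equiv.Perm (Pt K)} (hg : g ∈ PSO K δ) :
    g • sympPoints F K = sympPoints F K := by
  refine smul_set_eq_of_forall_subset (H := PSO K δ) ?_ hg
  rintro _ ⟨A, hA, rfl⟩ p ⟨v, hv, hvp⟩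
  refine ⟨A.val *ᵥ v, fun h => hv (mulVec_injective A (by simp [h])), ?_⟩
  change _ ∈ (act (Matrix.GeneralLinearGroup.map (algebraMap F K) A) • p).submodule
  rw [submodule_act]
  exact ⟨_, hvp, map_mulVec A v⟩

include S

lemma PSO_le_PGammaU : PSO K δ ≤ PGammaU K q := by
  intro g hg
  refine ⟨smul_set_eq_of_forall_subset (H := PSO K δ) ?_ hg, ?_⟩
  · rintro _ ⟨A, hA, rfl⟩ ℓ hℓ
    exact act_smul_projLines _ hℓ
  · obtain ⟨A, hA, rfl⟩ := hg
    refine smul_setOf_forall _ fun v => ?_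
    rw [S.map_mem_GU hA v v]

lemma PSO_smul_extLines {g : Equiv.Perm (Pt K)} (hg : g ∈ PSO K δ) {ℓ : Set (Pt K)}
    (hℓ : ℓ ∈ extLines F K q) : g • ℓ ∈ extLines F K q := by
  refine ⟨?_, ?_⟩
  · obtain ⟨A, hA, rfl⟩ := hg
    exact act_smul_hermLines (S.map_mem_GU hA) hℓ.1
  · rw [← PSO_smul_sympPoints hg, Set.disjoint_smul_set]
    exact hℓ.2

omit S [CharP K 2] in
lemma POmega_le_PSO : POmega K δ ≤ PSO K δ := Subgroup.map_mono Omega_le_SO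

lemma relIndex_eq_two : (POmega K δ).relIndex (PSO K δ) = 2 := by
  have hv : quadForm δ ![1, 0, 0, 0] ≠ 0 := by simp [quadForm]
  refine Subgroup.relIndex_eq_two_iff_exists_notMem_and'.2 ⟨_, ⟨_, reflectionGL_mem_SO hv, rfl⟩,
    reflectionGL_notMem_POmega S.algebraMap_delta hv, fun b hb => ?_⟩
  exact (mem_POmega_or S.anisotropic hv hb).symm

lemma indexTwoTransitive [Finite K] :
    IndexTwoTransitive (POmega K δ) (PSO K δ) (extLines F K q) where
  le := POmega_le_PSO
  index_two := S.relIndex_eq_two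
  smul_mem _ hg _ hx := S.PSO_smul_extLines hg hx
  transitive _ hx _ hy := S.exists_mem_PSO_smul_eq hx hy
  stabilizer _ hx _ hg h := S.mem_POmega_of_smul_eq hx hg h
  nonempty := S.extLines_nonempty

lemma exists_odd_smul_eq {P : Pt K} (hP : P ∈ extPoints F K q) :
    ∃ r ∈ PSO K δ, r ∉ POmega K δ ∧ r • P = P := by
  obtain ⟨v, hv, h⟩ := S.exists_reflection_smul_eq hP
  exact ⟨_, ⟨_, reflectionGL_mem_SO hv, rfl⟩, reflectionGL_notMem_POmega S.algebraMap_delta hv, h⟩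

/-- The orbits of `PΩ⁻(4, q)` on external lines are relative hemisystems. -/
lemma isRelativeHemisystem [Finite K] {R : Set (Set (Pt K))} (hR : R ∈ pwFamily K q δ) :
    IsRelativeHemisystem F K q R := by
  obtain ⟨ℓ, hℓ, rfl⟩ := hR
  have T := S.indexTwoTransitive
  have : Finite (Pt K) := Quotient.finite _
  refine ⟨T.orbit_subset hℓ, fun P hP => ?_⟩
  obtain ⟨r, hr, hr', hrP⟩ := S.exists_odd_smul_eq hP
  set A := {m ∈ MulAction.orbit (POmega K δ) ℓ | P ∈ m}
  have hmem : ∀ m : Set (Pt K), P ∈ r⁻¹ • m ↔ P ∈ m := by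
    intro m
    rw [Set.mem_inv_smul_set_iff, hrP]
  -- The odd element r fixes P and exchanges the two orbits, so it carries the lines of one orbit
  -- through P onto those of the other.
  have hunion : {m ∈ extLines F K q | P ∈ m} = A ∪ r • A := by
    ext m
    rw [Set.mem_union, Set.mem_smul_set_iff_inv_smul_mem]
    change (m ∈ extLines F K q ∧ P ∈ m) ↔ (m ∈ MulAction.orbit (POmega K δ) ℓ ∧ P ∈ m) ∨
      (r⁻¹ • m ∈ MulAction.orbit (POmega K δ) ℓ ∧ P ∈ r⁻¹ • m)
    rw [hmem, ← or_and_right, ← Set.mem_smul_set_iff_inv_smul_mem]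
    refine and_congr_left fun _ => ⟨fun hm => T.mem_orbit_or hℓ hm hr hr', ?_⟩
    rintro (h | h)
    · exact T.orbit_subset hℓ h
    · rw [T.smul_orbit hr] at h
      exact T.orbit_subset (T.smul_mem r hr ℓ hℓ) h
  have hdisj : Disjoint A (r • A) :=
    (T.disjoint_smul_orbit hℓ hr hr').mono (fun m hm => hm.1)
      (Set.smul_set_mono fun m hm => hm.1)
  rw [hunion, Set.ncard_union_eq hdisj (Set.toFinite _) (Set.toFinite _), Set.ncard_smul_set,
    two_mul]

/-- Stability of the first regulus already forces evenness, and even elements stabilise both. -/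
lemma POmega_eq : POmega K δ = PSO K δ ⊓
    MulAction.stabilizer (Equiv.Perm (Pt K)) (regulus₁ q υ) ⊓
    MulAction.stabilizer (Equiv.Perm (Pt K)) (regulus₂ q υ) := by
  rw [regulus₁_eq S.upsilon_pow, regulus₂_eq S.upsilon_pow]
  refine le_antisymm (fun g hg => ?_) fun g hg => ?_
  · have h := POmega_le_stabilizer S.algebraMap_delta hg
    exact ⟨⟨POmega_le_PSO hg, h.1⟩, h.2⟩
  · exact (mem_POmega_iff S.algebraMap_delta S.anisotropic hg.1.1).2 hg.1.2

end ArtinSchreierPair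

end RelHemi

theorem mainTheorem5 {F K : Type*} [Field F] [Field K] [Algebra F K]
    (k q : ℕ) (hk : 0 < k) (hq : q = 2 ^ k)
    (hF : Nat.card F = q) (hK : Module.finrank F K = 2)
    (υ : K) (hυ : υ ^ q + υ = 1)
    (δ : F) (hδ : algebraMap F K δ = υ ^ (q + 1)) :
    -- the two groups fix the hyperbolic quadric, and are its stabiliser in `PGU(4, q)`
    -- and the stabiliser therein of its reguli
    RelHemi.PSO K δ = RelHemi.PGU K q ⊓
        MulAction.stabilizer (Equiv.Perm (RelHemi.Pt K))
          (RelHemi.quadricPoints (υ ^ (q + 1))) ∧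
    RelHemi.POmega K δ = RelHemi.PSO K δ ⊓
        MulAction.stabilizer (Equiv.Perm (RelHemi.Pt K)) (RelHemi.regulus₁ q υ) ⊓
        MulAction.stabilizer (Equiv.Perm (RelHemi.Pt K)) (RelHemi.regulus₂ q υ) ∧
    -- the pair satisfies the point-stabiliser criterion, hence the index-two criterion
    RelHemi.PointStabiliserCriterion K q δ (RelHemi.POmega K δ) (RelHemi.PSO K δ) ∧
    RelHemi.IndexTwoCriterion F K q (RelHemi.POmega K δ) (RelHemi.PSO K δ) ∧
    -- the sets determined by the pair are exactly the two Penttila–Williford ones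
    (RelHemi.pwFamily K q δ).ncard = 2 ∧
    (∀ R : Set (Set (RelHemi.Pt K)),
      RelHemi.DeterminedBy F K q (RelHemi.POmega K δ) (RelHemi.PSO K δ) R ↔
        R ∈ RelHemi.pwFamily K q δ) ∧
    -- they are relative hemisystems admitting `PΩ⁻(4, q)`
    (∀ R ∈ RelHemi.pwFamily K q δ, RelHemi.IsRelativeHemisystem F K q R ∧
      ∀ g ∈ RelHemi.POmega K δ, g • R = R) := by
  subst hq
  have : CharP F 2 := RelHemi.charP_two_of_natCard hF
  have : CharP K 2 := charP_of_injective_algebraMap (algebraMap F K).injective 2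
  have : Finite F := Nat.finite_of_card_ne_zero (by rw [hF]; positivity)
  have : Module.Finite F K := Module.finite_of_finrank_pos (by omega)
  have : Finite K := Module.finite_of_finite F
  have S := RelHemi.artinSchreierPair rfl hF hK hυ hδ
  have T := S.indexTwoTransitive
  refine ⟨?_, S.POmega_eq, ⟨le_rfl, ?_, ?_⟩, ⟨T.lt, S.PSO_le_PGammaU, ?_, T.index_two,
    T.actsSemiregularly, fun g hg => T.kernel hg, ?_⟩, T.ncard_orbitsOn,
    T.exists_representatives_iff, fun R hR => ⟨S.isRelativeHemisystem hR, fun g hg => ?_⟩⟩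
  · rw [← hδ, S.algebraMap_delta]
    exact S.PSO_eq
  · exact (inf_eq_right.2 T.le).symm
  · intro P hP hle
    obtain ⟨r, hr, hr', h⟩ := S.exists_odd_smul_eq hP
    exact hr' (hle ⟨hr, h⟩)
  · exact fun g hg => RelHemi.ArtinSchreierPair.PSO_smul_sympPoints hg
  · exact RelHemi.IndexTwoTransitive.orbitsOn_eq T.le T.index_two fun P hP =>
      S.exists_odd_smul_eq hP
  · exact (T.kernel (T.le hg)).2 hg R hR
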